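/- **Setting.** Let $X$ be a locally compact Hausdorff space with countable base, $\mathcal V$ a base of its topology consisting of relatively compact open sets and, for every $V\in\mathcal V$, let $H_V$ be a boundary kernel for $V$, that is, a kernel on $X$ with its Borel sets such that $H_V(x,X\setminus\partial V)=0$ for $x\in V$ and $H_V(x,\cdot)=\varepsilon_x$ (Dirac measure at $x$) for $x\notin V$. Write $H_Vf(x)=\int f\,dH_V(x,\cdot)$ and, for open $U$, $\mathcal V(U)=\{W\in\mathcal V:\overline W\subset U\}$. A lower semicontinuous $u:U\to\,]-\infty,\infty]$ is *hyperharmonic* on $U$ if $H_Wu(x)\le u(x)$ for all $x\in W\in\mathcal V(U)$; if this is only required for $x\in U$, $W\in\mathcal W(x)$, where each $\mathcal W(x)$, $x\in U$, is a fundamental system of neighborhoods of $x$ from $\mathcal V(U)$ (a *local choice* $\mathcal W$ from $\mathcal V$ in $U$), then $u$ is *$\mathcal W$-hyperharmonic*. A continuous real function $h$ on $U$ is *harmonic* on $U$ if $H_Vh=h$ for all $V\in\mathcal V(U)$. A hyperharmonic function $s$ on $U$ is *superharmonic* if, for every $V\in\mathcal V(U)$, $H_Vs$ is locally bounded on $V$.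 Suppose that $(H_V)_{V\in\mathcal V}$ is a *normal Bauer family of harmonic boundary kernels*, that is, for every $V\in\mathcal V$: (1) $H_WH_V=H_V$ for all $W\in\mathcal V$ with $W\subset V$; (2) $H_Vf$ is continuous on $X$ for every continuous $f:X\to\mathbb R$, and $H_V1=1$; (3) for some local choice $\mathcal W$ from $\mathcal V$ in $V$, the $\mathcal W$-hyperharmonic functions $u\ge 0$ on $V$ separate the points of $V$; (4) $H_Vf$ is continuous on $V$ for every bounded Borel function $f$ on $X$. Suppose moreover that it is *elliptic*: every harmonic function $h\ge0$ on a connected open set $U$ is identically zero or strictly positive on $U$. An open set $W$ is a *$\mathcal P$-set* if the hyperharmonic functions $u\ge0$ on $W$ separate the points of $W$. A compact $K$ contained in a $\mathcal P$-set is *stable* if, for every $z\in\partial K$, there are an open neighborhood $W'$ of $z$ and a strictly positive superharmonic function $s$ on $W'\setminus K$ with $\lim_{x\to z}s(x)=0$. A compact $K\ne\emptyset$ is *strongly stable* if it is contained in a $\mathcal P$-set $W'$ for which there is a strictly positive harmonic function on $W'\setminus K$ which tends to zero at $\partial K$. **Proposition.** Let $L$ be a compact subset of a $\mathcal P$-set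 $W$. Then there exists a stable compact neighborhood $K$ of $L$ with $K\subset W$. Moreover, $K$ can be chosen to be a finite union of strongly stable compact sets contained in $W$, each of which is a neighborhood of a point of $L$. -/

import Mathlib

open Set Filter Topology MeasureTheory ProbabilityTheory

namespace BauerFamily

variable {X : Type*} [TopologicalSpace X] [MeasurableSpace X]

/-- `𝒱(U)`: the members of `𝒱` whose closure is contained in `U`. -/
def inside (𝒱 : Set (Set X)) (U : Set X) : Set (Set X) :=
  {W | W ∈ 𝒱 ∧ closure W ⊆ U}

/-- The kernel `T` is a boundary kernel for `U`: for `x ∈ U` the measure `T(x, ·)` does not charge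
the complement of `∂U`, and for `x ∉ U` it is the Dirac measure at `x`. -/
def IsBoundaryKernel (T : Kernel X X) (U : Set X) : Prop :=
  (∀ x ∈ U, T x (frontier U)ᶜ = 0) ∧ ∀ x ∉ U, T x = Measure.dirac x

/-- The integral `∫ u dμ ∈ [-∞, ∞]` of a numerical function, as the integral of the positive part
minus the integral of the negative part. It is only used when the negative part has a finite
integral: there `u` is lower semicontinuous and `> -∞` on an open set `U`, and `μ = H_W(x, ·)` is a
probability measure carried by the compact set `∂W ⊆ U`. -/
noncomputable def eintegral (μ : Measure X) (u : X → EReal) : EReal :=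
  ((∫⁻ y, (u y).toENNReal ∂μ : ENNReal) : EReal) -
    ((∫⁻ y, (-u y).toENNReal ∂μ : ENNReal) : EReal)

/-- A local choice from `𝒱` in `U`: for every `x ∈ U`, `𝒲 x` is a fundamental system of
neighborhoods of `x` consisting of members of `𝒱(U)`. -/
def IsLocalChoice (𝒱 : Set (Set X)) (U : Set X) (𝒲 : X → Set (Set X)) : Prop :=
  ∀ x ∈ U, (∀ W ∈ 𝒲 x, W ∈ inside 𝒱 U ∧ W ∈ 𝓝 x) ∧ ∀ N ∈ 𝓝 x, ∃ W ∈ 𝒲 x, W ⊆ N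

/-- `u` (only its values on `U` matter) is `𝒲`-hyperharmonic on `U`: it is lower semicontinuous
on `U` with values in `]-∞, ∞]`, and `H_W u(x) ≤ u(x)` for `x ∈ U` and `W ∈ 𝒲 x`. -/
def IsHyperharmonicFor (H : Set X → Kernel X X) (𝒲 : X → Set (Set X)) (U : Set X)
    (u : X → EReal) : Prop :=
  LowerSemicontinuousOn u U ∧ (∀ x ∈ U, u x ≠ ⊥) ∧
    ∀ x ∈ U, ∀ W ∈ 𝒲 x, eintegral (H W x) u ≤ u x

/-- `u` is hyperharmonic on `U`: the preceding notion for the family of all `W ∈ 𝒱(U)` that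
contain `x`. -/
def IsHyperharmonic (𝒱 : Set (Set X)) (H : Set X → Kernel X X) (U : Set X) (u : X → EReal) :
    Prop :=
  IsHyperharmonicFor H (fun x => {W | W ∈ inside 𝒱 U ∧ x ∈ W}) U u

/-- `h` (only its values on `U` matter) is harmonic on `U`: it is real and continuous on `U`, and
`H_V h = h` for all `V ∈ 𝒱(U)`. (At points outside `V` the last equality holds trivially.) -/
def IsHarmonic (𝒱 : Set (Set X)) (H : Set X → Kernel X X) (U : Set X) (h : X → ℝ) : Prop :=
  ContinuousOn h U ∧ ∀ V ∈ inside 𝒱 U, ∀ x ∈ V, ∫ y, h y ∂(H V x) = h x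

/-- `s` is superharmonic on `U`: it is hyperharmonic on `U`, and, for every `V ∈ 𝒱(U)`,
the function `H_V s` is locally bounded on `V`. -/
def IsSuperharmonic (𝒱 : Set (Set X)) (H : Set X → Kernel X X) (U : Set X) (s : X → EReal) :
    Prop :=
  IsHyperharmonic 𝒱 H U s ∧
    ∀ V ∈ inside 𝒱 U, ∀ x ∈ V, ∃ C : ℝ, ∀ᶠ y in 𝓝[V] x,
      ((-C : ℝ) : EReal) ≤ eintegral (H V y) s ∧ eintegral (H V y) s ≤ ((C : ℝ) : EReal)

/-- `(H_V)`, `V ∈ 𝒱`, is a normal Bauer family of harmonic boundary kernels on `X`.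
The values of `H` at sets outside `𝒱` are irrelevant. -/
structure IsNormalBauerFamily (𝒱 : Set (Set X)) (H : Set X → Kernel X X) : Prop where
  /-- `𝒱` is a base for the topology -/
  isBasis : TopologicalSpace.IsTopologicalBasis 𝒱
  /-- consisting of relatively compact (open) sets. -/
  isCompact_closure : ∀ V ∈ 𝒱, IsCompact (closure V)
  isBoundaryKernel : ∀ V ∈ 𝒱, IsBoundaryKernel (H V) V
  /-- `H_W H_V = H_V` whenever `W ⊆ V`, where `(S T)(x, ·) = ∫ T(y, ·) S(x, dy)`. -/
  comp_eq : ∀ V ∈ 𝒱, ∀ W ∈ 𝒱, W ⊆ V → (H V) ∘ₖ (H W) = H V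
  /-- `H_V f` is continuous on `X` for every continuous real function `f` on `X`. -/
  continuous_apply : ∀ V ∈ 𝒱, ∀ f : X → ℝ, Continuous f →
    Continuous fun x => ∫ y, f y ∂(H V x)
  /-- `H_V 1 = 1`. -/
  apply_univ : ∀ V ∈ 𝒱, ∀ x, H V x univ = 1
  /-- For some local choice `𝒲` from `𝒱` in `V`, the positive `𝒲`-hyperharmonic functions on `V`
  separate the points of `V`. -/
  separates : ∀ V ∈ 𝒱, ∃ 𝒲 : X → Set (Set X), IsLocalChoice 𝒱 V 𝒲 ∧
    ∀ x ∈ V, ∀ y ∈ V, x ≠ y →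
      ∃ u : X → EReal, IsHyperharmonicFor H 𝒲 V u ∧ (∀ z ∈ V, 0 ≤ u z) ∧ u x ≠ u y
  /-- `H_V f` is continuous on `V` for every bounded Borel function `f` on `X`. -/
  continuousOn_apply : ∀ V ∈ 𝒱, ∀ f : X → ℝ, Measurable f → (∃ C : ℝ, ∀ x, |f x| ≤ C) →
    ContinuousOn (fun x => ∫ y, f y ∂(H V x)) V

/-- The family is elliptic: every harmonic function `h ≥ 0` on a connected open set is identically
zero or strictly positive. -/
def IsElliptic (𝒱 : Set (Set X)) (H : Set X → Kernel X X) : Prop :=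
  ∀ U : Set X, IsOpen U → IsConnected U → ∀ h : X → ℝ, IsHarmonic 𝒱 H U h →
    (∀ x ∈ U, 0 ≤ h x) → (∀ x ∈ U, h x = 0) ∨ ∀ x ∈ U, 0 < h x

/-- A `𝒫`-set: an open set `U` such that the positive hyperharmonic functions on `U` separate the
points of `U`. -/
def IsPSet (𝒱 : Set (Set X)) (H : Set X → Kernel X X) (U : Set X) : Prop :=
  IsOpen U ∧ ∀ x ∈ U, ∀ y ∈ U, x ≠ y →
    ∃ u : X → EReal, IsHyperharmonic 𝒱 H U u ∧ (∀ z ∈ U, 0 ≤ u z) ∧ u x ≠ u y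

/-- `K` is a stable compact: it is compact, contained in a `𝒫`-set, and for every `z ∈ ∂K` there
are an open neighborhood `W` of `z` and a strictly positive superharmonic function `s` on `W \ K`
such that `s(x) → 0` as `x → z`. -/
def IsStable (𝒱 : Set (Set X)) (H : Set X → Kernel X X) (K : Set X) : Prop :=
  IsCompact K ∧ (∃ W, IsPSet 𝒱 H W ∧ K ⊆ W) ∧
    ∀ z ∈ frontier K, ∃ W : Set X, IsOpen W ∧ z ∈ W ∧ ∃ s : X → EReal,
      IsSuperharmonic 𝒱 H (W \ K) s ∧ (∀ x ∈ W \ K, 0 < s x) ∧ Tendsto s (𝓝[W \ K] z) (𝓝 0)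

/-- `K` is a strongly stable compact: it is compact, non-empty, and contained in a `𝒫`-set `W` for
which there is a strictly positive harmonic function on `W \ K` that tends to zero at `∂K`. -/
def IsStronglyStable (𝒱 : Set (Set X)) (H : Set X → Kernel X X) (K : Set X) : Prop :=
  IsCompact K ∧ K.Nonempty ∧ ∃ W, IsPSet 𝒱 H W ∧ K ⊆ W ∧ ∃ h : X → ℝ,
    IsHarmonic 𝒱 H (W \ K) h ∧ (∀ x ∈ W \ K, 0 < h x) ∧
      ∀ z ∈ frontier K, Tendsto h (𝓝[W \ K] z) (𝓝 0)

end BauerFamily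

/-! It suffices to find, inside `W`, a strongly stable compact neighborhood of each point of `L`.
Finitely many of these cover `L`. A boundary point of their union `K` lies on the boundary of one
piece, and the harmonic function of that piece, restricted to the complement of `K`, shows stability
there.

For a point `x`, such a neighborhood is a superlevel set `{c ≤ p}` of a function `p > 0` on an open
`G ∋ x`, harmonic off a compact `C ∋ x` and vanishing at the boundary of `G`; if `c` lies below the
minimum of `p` on `C`, then `c - p` is the required harmonic function. Here `p = w - H_V w`, where
`w` is the smallest supermean majorant of a bump function at `x` (`IsPSet.exists_reduced`), `V ∈ 𝒱`
is a neighborhood of `x`, and `G` is the component of `x` in `V`.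

The crux is that `p` has no zero in `G` (`IsPSet.exists_potential`). Otherwise the minimum principle
gives `w = H_V w` on `G`, so `w` is harmonic on the whole component of `x` in `W`, attains its
maximum `1` there, and equals `1`. By minimality of `w`, every bounded supermean function then
attains its minimum over that component on `C`, hence is constant, contradicting separation of
points.

Behind this are a maximum principle, obtained because `𝒫`-sets contain no nonempty absorbing compact
set (`IsPSet.not_absorbing`), and the consequence of ellipticity that locally absorbing relatively
closed subsets of a connected open set are trivial (`IsPSet.eq_empty_or_eq_of_absorbing`). -/

namespace BauerFamily

/-- Bounded Borel functions. -/
def IsBoundedBorel {X : Type*} [MeasurableSpace X] (f : X → ℝ) : Prop :=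
  Measurable f ∧ ∃ C : ℝ, ∀ x, |f x| ≤ C

/-! ### Bounded Borel functions and the equality case for means -/

section BoundedBorel

variable {X : Type*} [MeasurableSpace X] {f g : X → ℝ}

lemma IsBoundedBorel.integrable (hf : IsBoundedBorel f) (μ : Measure X) [IsFiniteMeasure μ] :
    Integrable f μ := by
  obtain ⟨hm, C, hC⟩ := hf
  exact Integrable.of_bound hm.aestronglyMeasurable C (Eventually.of_forall fun x => hC x)

lemma IsBoundedBorel.sub (hf : IsBoundedBorel f) (hg : IsBoundedBorel g) :
    IsBoundedBorel (fun x => f x - g x) := by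
  obtain ⟨hfm, C, hC⟩ := hf
  obtain ⟨hgm, D, hD⟩ := hg
  exact ⟨hfm.sub hgm, C + D, fun x => (abs_sub _ _).trans (add_le_add (hC x) (hD x))⟩

lemma isBoundedBorel_of_nonneg_of_le_one (hm : Measurable f) (h0 : ∀ x, 0 ≤ f x)
    (h1 : ∀ x, f x ≤ 1) : IsBoundedBorel f :=
  ⟨hm, 1, fun x => abs_le.2 ⟨by linarith [h0 x], h1 x⟩⟩

lemma IsBoundedBorel.integral_kernel (hf : IsBoundedBorel f) (T : Kernel X X) [IsMarkovKernel T] :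
    IsBoundedBorel (fun x => ∫ y, f y ∂(T x)) := by
  obtain ⟨hm, C, hC⟩ := hf
  refine ⟨hm.stronglyMeasurable.integral_kernel.measurable, C, fun x => ?_⟩
  have := norm_integral_le_of_norm_le_const (μ := T x) (f := f) (C := C)
    (Eventually.of_forall fun y => hC y)
  simpa using this

/-- A bounded Borel function which is at least `m` almost everywhere and whose mean is at most `m`
equals `m` almost everywhere. -/
lemma IsBoundedBorel.measure_ne_eq_zero_of_integral_le (hf : IsBoundedBorel f) {μ : Measure X}
    [IsProbabilityMeasure μ] {m : ℝ} (hm : ∀ᵐ y ∂μ, m ≤ f y) (hi : ∫ y, f y ∂μ ≤ m) :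
    μ {y | f y ≠ m} = 0 := by
  have hint := hf.integrable μ
  have h0 : ∫ y, (f y - m) ∂μ = 0 := by
    apply le_antisymm
    · rw [integral_sub hint (integrable_const _)]
      simpa using hi
    · exact integral_nonneg_of_ae (hm.mono fun y hy => sub_nonneg.2 hy)
  rw [integral_eq_zero_iff_of_nonneg_ae (hm.mono fun y hy => sub_nonneg.2 hy)
    (hint.sub (integrable_const _))] at h0
  have : ∀ᵐ y ∂μ, f y = m := h0.mono fun y hy => sub_eq_zero.1 hy
  exact ae_iff.1 this

lemma IsBoundedBorel.measure_ne_eq_zero_of_le_integral (hf : IsBoundedBorel f) {μ : Measure X}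
    [IsProbabilityMeasure μ] {m : ℝ} (hm : ∀ᵐ y ∂μ, f y ≤ m) (hi : m ≤ ∫ y, f y ∂μ) :
    μ {y | f y ≠ m} = 0 := by
  have hneg : IsBoundedBorel (fun y => -f y) := ⟨hf.1.neg, by simpa using hf.2⟩
  have := hneg.measure_ne_eq_zero_of_integral_le (μ := μ) (m := -m)
    (hm.mono fun y hy => neg_le_neg hy) (by rw [integral_neg]; linarith)
  simpa using this

end BoundedBorel

/-! ### Elementary properties of the harmonic kernels -/

section Kernels

variable {X : Type*} [TopologicalSpace X] [MeasurableSpace X] {𝒱 : Set (Set X)}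
  {H : Set X → Kernel X X}

lemma IsNormalBauerFamily.isMarkovKernel (hH : IsNormalBauerFamily 𝒱 H) {V : Set X}
    (hV : V ∈ 𝒱) : IsMarkovKernel (H V) :=
  ⟨fun x => ⟨hH.apply_univ V hV x⟩⟩

lemma IsNormalBauerFamily.isOpen (hH : IsNormalBauerFamily 𝒱 H) {V : Set X} (hV : V ∈ 𝒱) :
    IsOpen V :=
  hH.isBasis.isOpen hV

lemma IsNormalBauerFamily.measure_compl_eq_zero (hH : IsNormalBauerFamily 𝒱 H) {V E : Set X}
    (hV : V ∈ 𝒱) (hE : closure V ⊆ E) {x : X} (hx : x ∈ V) : H V x Eᶜ = 0 :=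
  measure_mono_null (compl_subset_compl.2 (frontier_subset_closure.trans hE))
    ((hH.isBoundaryKernel V hV).1 x hx)

lemma IsNormalBauerFamily.ae_mem (hH : IsNormalBauerFamily 𝒱 H) {V E : Set X}
    (hV : V ∈ 𝒱) (hE : closure V ⊆ E) {x : X} (hx : x ∈ V) : ∀ᵐ y ∂(H V x), y ∈ E :=
  ae_iff.2 (hH.measure_compl_eq_zero hV hE hx)

lemma IsNormalBauerFamily.ae_mem_frontier (hH : IsNormalBauerFamily 𝒱 H) {V : Set X}
    (hV : V ∈ 𝒱) {x : X} (hx : x ∈ V) : ∀ᵐ y ∂(H V x), y ∈ frontier V :=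
  ae_iff.2 ((hH.isBoundaryKernel V hV).1 x hx)

lemma IsNormalBauerFamily.integral_integral (hH : IsNormalBauerFamily 𝒱 H) {U V : Set X}
    (hU : U ∈ 𝒱) (hV : V ∈ 𝒱) (hUV : U ⊆ V) {f : X → ℝ} (hf : IsBoundedBorel f) (x : X) :
    ∫ y, (∫ z, f z ∂(H V y)) ∂(H U x) = ∫ z, f z ∂(H V x) := by
  have := hH.isMarkovKernel hU
  have := hH.isMarkovKernel hV
  conv_rhs => rw [← hH.comp_eq V hV U hU hUV]
  exact (Kernel.integral_comp (hf.integrable _)).symm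

lemma IsNormalBauerFamily.integral_of_notMem [BorelSpace X] [T2Space X]
    (hH : IsNormalBauerFamily 𝒱 H) {V : Set X} (hV : V ∈ 𝒱) {x : X} (hx : x ∉ V) (f : X → ℝ) :
    ∫ y, f y ∂(H V x) = f x := by
  rw [(hH.isBoundaryKernel V hV).2 x hx, integral_dirac]

lemma IsNormalBauerFamily.exists_mem_closure_subset [T2Space X] [LocallyCompactSpace X]
    (hH : IsNormalBauerFamily 𝒱 H) {x : X} {O : Set X} (hO : O ∈ 𝓝 x) :
    ∃ U ∈ 𝒱, x ∈ U ∧ closure U ⊆ O := by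
  obtain ⟨F, hF, hFc, hFO⟩ := exists_mem_nhds_isClosed_subset hO
  obtain ⟨U, hU, hxU, hUF⟩ := hH.isBasis.mem_nhds_iff.1 hF
  exact ⟨U, hU, hxU, (closure_minimal hUF hFc).trans hFO⟩

end Kernels

/-! ### Absorbing sets and the maximum principle in a `𝒫`-set -/

section PSet

variable {X : Type*} [TopologicalSpace X] [MeasurableSpace X] {𝒱 : Set (Set X)}
  {H : Set X → Kernel X X} {W : Set X}

/-- Bounded positive lower semicontinuous functions `f` with `H_U f ≤ f` on `U`, `U ∈ 𝒱(W)`. -/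
structure IsBoundedSupermean (𝒱 : Set (Set X)) (H : Set X → Kernel X X) (W : Set X) (f : X → ℝ) :
    Prop where
  lowerSemicontinuousOn : LowerSemicontinuousOn f W
  isBoundedBorel : IsBoundedBorel f
  nonneg : ∀ x, 0 ≤ f x
  integral_le : ∀ U ∈ inside 𝒱 W, ∀ x ∈ U, ∫ y, f y ∂(H U x) ≤ f x

lemma IsPSet.mono {U : Set X} (hW : IsPSet 𝒱 H W) (hU : IsOpen U) (hUW : U ⊆ W) :
    IsPSet 𝒱 H U := by
  refine ⟨hU, fun x hx y hy hxy => ?_⟩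
  obtain ⟨u, ⟨h1, h2, h3⟩, h0, hne⟩ := hW.2 x (hUW hx) y (hUW hy) hxy
  exact ⟨u, ⟨h1.mono hUW, fun z hz => h2 z (hUW hz),
    fun z hz V hV => h3 z (hUW hz) V ⟨⟨hV.1.1, hV.1.2.trans hUW⟩, hV.2⟩⟩,
    fun z hz => h0 z (hUW hz), hne⟩

/-- On a `𝒫`-set, bounded supermean functions separate the points. -/
lemma IsPSet.exists_isBoundedSupermean [BorelSpace X] (hH : IsNormalBauerFamily 𝒱 H)
    (hW : IsPSet 𝒱 H W) {x y : X} (hx : x ∈ W) (hy : y ∈ W) (hxy : x ≠ y) :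
    ∃ f : X → ℝ, IsBoundedSupermean 𝒱 H W f ∧ f x ≠ f y := by
  classical
  obtain ⟨u, ⟨hlsc, -, hle⟩, h0, hne⟩ := hW.2 x hx y hy hxy
  set v : X → ENNReal := fun z => if z ∈ W then (u z).toENNReal else 0 with hv
  have hvW : ∀ z ∈ W, v z = (u z).toENNReal := fun z hz => if_pos hz
  have hvu : ∀ z ∈ W, ((v z : ENNReal) : EReal) = u z := fun z hz => by
    rw [hvW z hz, EReal.coe_toENNReal (h0 z hz)]
  have hvm : LowerSemicontinuous v := by
    intro z a ha
    by_cases hz : z ∈ W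
    · have h1 : ((a : ENNReal) : EReal) < u z := by
        rw [← hvu z hz]; exact EReal.coe_ennreal_lt_coe_ennreal_iff.2 ha
      have h2 := hlsc z hz _ h1
      rw [hW.1.nhdsWithin_eq hz] at h2
      filter_upwards [h2, hW.1.mem_nhds hz] with w hw hwW
      rw [← hvu w hwW] at hw
      exact EReal.coe_ennreal_lt_coe_ennreal_iff.1 hw
    · simp [hv, hz] at ha
  have hvle : ∀ U ∈ inside 𝒱 W, ∀ z ∈ U, ∫⁻ w, v w ∂(H U z) ≤ v z := by
    intro U hU z hz
    have hzW : z ∈ W := hU.2 (subset_closure hz)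
    have h1 := hle z hzW U ⟨hU, hz⟩
    have hae := hH.ae_mem hU.1 hU.2 hz
    have hpos : ∫⁻ w, (u w).toENNReal ∂(H U z) = ∫⁻ w, v w ∂(H U z) :=
      lintegral_congr_ae (hae.mono fun w hw => (hvW w hw).symm)
    have hneg : ∫⁻ w, (-u w).toENNReal ∂(H U z) = 0 := by
      rw [lintegral_congr_ae (g := fun _ => 0) (hae.mono fun w hw => by
        simpa [EReal.toENNReal_eq_zero_iff] using h0 w hw)]
      simp
    rw [eintegral, hpos, hneg, ← hvu z hzW] at h1
    simpa using h1
  have hvne : v x ≠ v y := fun h => hne (by rw [← hvu x hx, ← hvu y hy, h])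
  -- Truncating at a level between the two values makes the function bounded and keeps them apart;
  -- minima with constants remain supermean.
  obtain ⟨n, hn⟩ : ∃ n : NNReal, min (v x) n ≠ min (v y) n := by
    rcases lt_or_gt_of_ne hvne with h | h
    · obtain ⟨n, h1, h2⟩ := ENNReal.lt_iff_exists_nnreal_btwn.1 h
      exact ⟨n, by rw [min_eq_left h1.le, min_eq_right h2.le]; exact h1.ne⟩
    · obtain ⟨n, h1, h2⟩ := ENNReal.lt_iff_exists_nnreal_btwn.1 h
      exact ⟨n, by rw [min_eq_left h1.le, min_eq_right h2.le]; exact h1.ne'⟩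
  have hfin : ∀ z, min (v z) n ≠ ⊤ := fun z =>
    ((min_le_right _ _).trans_lt ENNReal.coe_lt_top).ne
  have hmeas : Measurable fun z => min (v z) n := hvm.measurable.min measurable_const
  refine ⟨fun z => (min (v z) n).toReal, ⟨?_, ⟨hmeas.ennreal_toReal, n, fun z => ?_⟩,
    fun z => ENNReal.toReal_nonneg, ?_⟩, ?_⟩
  · refine LowerSemicontinuous.lowerSemicontinuousOn ?_ _
    intro z a ha
    rcases lt_or_ge a 0 with h | h
    · exact Eventually.of_forall fun w => h.trans_le ENNReal.toReal_nonneg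
    have h1 : ENNReal.ofReal a < min (v z) n := (ENNReal.ofReal_lt_iff_lt_toReal h (hfin z)).2 ha
    filter_upwards [hvm z _ (h1.trans_le (min_le_left _ _))] with w hw
    exact (ENNReal.ofReal_lt_iff_lt_toReal h (hfin w)).1
      (lt_min hw (h1.trans_le (min_le_right _ _)))
  · rw [abs_of_nonneg ENNReal.toReal_nonneg]
    simpa using ENNReal.toReal_mono ENNReal.coe_ne_top (min_le_right (v z) n)
  · intro U hU z hz
    have := hH.isMarkovKernel hU.1
    rw [integral_toReal hmeas.aemeasurable (Eventually.of_forall fun w => (hfin w).lt_top)]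
    refine ENNReal.toReal_mono (hfin z) (le_min ?_ ?_)
    · exact (lintegral_mono fun w => min_le_left _ _).trans (hvle U hU z hz)
    · refine (lintegral_mono fun w => min_le_right _ _).trans ?_
      simp
  · intro h
    exact hn ((ENNReal.toReal_eq_toReal_iff' (hfin x) (hfin y)).1 h)

variable [T2Space X] [SecondCountableTopology X] [BorelSpace X]

/-- A `𝒫`-set contains no non-empty absorbing compact set. -/
lemma IsPSet.not_absorbing (hH : IsNormalBauerFamily 𝒱 H) (hW : IsPSet 𝒱 H W) {M : Set X}
    (hM : IsCompact M) (hne : M.Nonempty) (hMW : M ⊆ W)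
    (habs : ∀ y ∈ M, ∃ U ∈ inside 𝒱 W, y ∈ U ∧ H U y Mᶜ = 0) : False := by
  have habs' : ∀ y, ∃ U, y ∈ M → U ∈ inside 𝒱 W ∧ y ∈ U ∧ H U y Mᶜ = 0 := by
    intro y
    by_cases hy : y ∈ M
    · obtain ⟨U, h1, h2⟩ := habs y hy
      exact ⟨U, fun _ => ⟨h1, h2⟩⟩
    · exact ⟨∅, fun h => absurd h hy⟩
  choose U hU using habs'
  -- Zorn's lemma yields a minimal absorbing set, with one test set `U y` fixed per point.
  let S : Set (Set X) := {A | A ⊆ M ∧ IsClosed A ∧ A.Nonempty ∧ ∀ y ∈ A, H (U y) y Aᶜ = 0}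
  obtain ⟨A, -, hA⟩ := zorn_superset_nonempty S (by
    intro c hc hchain hcne
    refine ⟨⋂₀ c, ⟨?_, isClosed_sInter fun A hA => (hc hA).2.1, ?_, ?_⟩,
      fun A hA => sInter_subset_of_mem hA⟩
    · obtain ⟨A, hA⟩ := hcne
      exact (sInter_subset_of_mem hA).trans (hc hA).1
    · have : Nonempty c := hcne.to_subtype
      refine IsCompact.nonempty_sInter_of_directed_nonempty_isCompact_isClosed ?_
        (fun A hA => (hc hA).2.2.1)
        (fun A hA => hM.of_isClosed_subset (hc hA).2.1 (hc hA).1) (fun A hA => (hc hA).2.1)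
      exact fun A hA B hB => (hchain.total hA hB).elim (fun h => ⟨A, hA, Subset.rfl, h⟩)
        fun h => ⟨B, hB, h, Subset.rfl⟩
    · intro y hy
      -- By the Lindelöf property countably many complements suffice, so their union is still null.
      obtain ⟨T, hTc, hTS, hTe⟩ := TopologicalSpace.isOpen_sUnion_countable (compl '' c) (by
        rintro _ ⟨A, hA, rfl⟩
        exact (hc hA).2.1.isOpen_compl)
      rw [compl_sInter, ← hTe]
      refine (measure_sUnion_null_iff hTc).2 fun B hB => ?_
      obtain ⟨A, hA, rfl⟩ := hTS hB
      exact (hc hA).2.2.2 y (hy A hA)) M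
    ⟨Subset.rfl, hM.isClosed, hne, fun y hy => (hU y hy).2.2⟩
  obtain ⟨hAM, hAc, hAne, hA0⟩ := hA.prop
  have hAcomp : IsCompact A := hM.of_isClosed_subset hAc hAM
  have hsing : ∀ x ∈ A, ∀ y ∈ A, x = y := by
    intro x hx y hy
    by_contra hxy
    obtain ⟨f, hf, hfxy⟩ := hW.exists_isBoundedSupermean hH (hMW (hAM hx)) (hMW (hAM hy)) hxy
    have hlsc : LowerSemicontinuousOn f A := hf.lowerSemicontinuousOn.mono (hAM.trans hMW)
    obtain ⟨a, ha, hmin⟩ := hlsc.exists_isMinOn hAne hAcomp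
    -- The minimum set of `f` on `A` is again absorbing, so by minimality `f` is constant on `A`.
    -- Since such `f` separate points, `A` is a singleton.
    have hmem : A ∩ f ⁻¹' Iic (f a) ∈ S := by
      refine ⟨inter_subset_left.trans hAM, (hlsc.isCompact_inter_preimage_Iic hAcomp _).isClosed,
        ⟨a, ha, mem_preimage.2 self_mem_Iic⟩, fun z hz => ?_⟩
      obtain ⟨hUz, hzU, -⟩ := hU z (hAM hz.1)
      have := hH.isMarkovKernel hUz.1
      have hae : ∀ᵐ w ∂(H (U z) z), w ∈ A := ae_iff.2 (hA0 z hz.1)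
      have h1 := hf.isBoundedBorel.measure_ne_eq_zero_of_integral_le
        (hae.mono fun w hw => isMinOn_iff.1 hmin w hw) ((hf.integral_le _ hUz z hzU).trans hz.2)
      refine measure_mono_null ?_ (measure_union_null (hA0 z hz.1) h1)
      intro w hw
      by_cases hwA : w ∈ A
      · exact Or.inr fun h => hw ⟨hwA, h.le⟩
      · exact Or.inl hwA
    have hsub := hA.le_of_le hmem inter_subset_left
    have hx' := le_antisymm (hsub hx).2 (isMinOn_iff.1 hmin x hx)
    have hy' := le_antisymm (hsub hy).2 (isMinOn_iff.1 hmin y hy)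
    exact hfxy (hx'.trans hy'.symm)
  obtain ⟨x, hx⟩ := hAne
  obtain ⟨hUx, hxU, -⟩ := hU x (hAM hx)
  have := hH.isMarkovKernel hUx.1
  -- The measure is carried both by `A = {x}` and by the boundary of `U x`, which misses `x`.
  have h1 : H (U x) x univ = 0 := by
    refine measure_mono_null ?_ (measure_union_null (hA0 x hx)
      ((hH.isBoundaryKernel _ hUx.1).1 x hxU))
    intro w _
    by_cases hw : w ∈ A
    · refine Or.inr fun hwf => ?_
      rw [hsing w hw x hx, (hH.isOpen hUx.1).frontier_eq] at hwf
      exact hwf.2 hxU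
    · exact Or.inl hw
  rw [hH.apply_univ _ hUx.1] at h1
  exact one_ne_zero h1

/-- The boundary maximum principle in a `𝒫`-set. -/
lemma IsPSet.nonpos_of_submean (hH : IsNormalBauerFamily 𝒱 H) (hW : IsPSet 𝒱 H W) {E : Set X}
    (hE : IsCompact E) (hEW : E ⊆ W) {g : X → ℝ} (hg : IsBoundedBorel g)
    (hgE : UpperSemicontinuousOn g E)
    (hsub : ∀ y ∈ E, 0 < g y →
      ∃ U ∈ inside 𝒱 W, y ∈ U ∧ closure U ⊆ E ∧ g y ≤ ∫ z, g z ∂(H U y)) :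
    ∀ y ∈ E, g y ≤ 0 := by
  by_contra! hcon
  obtain ⟨y₀, hy₀, hpos⟩ := hcon
  obtain ⟨a, ha, hmax⟩ := hgE.exists_isMaxOn ⟨y₀, hy₀⟩ hE
  have hapos : 0 < g a := hpos.trans_le (isMaxOn_iff.1 hmax y₀ hy₀)
  -- The set where `g` attains a positive maximum would be compact and absorbing.
  refine hW.not_absorbing hH (hgE.isCompact_inter_preimage_Ici hE (g a)) ⟨a, ha, mem_preimage.2 self_mem_Ici⟩
    (inter_subset_left.trans hEW) fun y hy => ?_
  obtain ⟨U, hU, hyU, hUE, hle⟩ := hsub y hy.1 (hapos.trans_le hy.2)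
  have := hH.isMarkovKernel hU.1
  have h1 := hg.measure_ne_eq_zero_of_le_integral
    ((hH.ae_mem hU.1 hUE hyU).mono fun w hw => isMaxOn_iff.1 hmax w hw) (le_trans hy.2 hle)
  refine ⟨U, hU, hyU, measure_mono_null ?_
    (measure_union_null (hH.measure_compl_eq_zero hU.1 hUE hyU) h1)⟩
  intro w hw
  by_cases hwE : w ∈ E
  · exact Or.inr fun h => hw ⟨hwE, h.ge⟩
  · exact Or.inl hwE

end PSet

end BauerFamily

/-! ### Connected components and ellipticity -/

namespace BauerFamily

/-- A set between a connected set and its closure is connected, so components are relatively closed.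
-/
lemma closure_connectedComponentIn_inter_subset {X : Type*} [TopologicalSpace X] {F : Set X}
    {x : X} (hx : x ∈ F) :
    closure (connectedComponentIn F x) ∩ F ⊆ connectedComponentIn F x := by
  refine IsPreconnected.subset_connectedComponentIn
    (isPreconnected_connectedComponentIn.subset_closure ?_ inter_subset_left)
    ⟨subset_closure (mem_connectedComponentIn hx), hx⟩ inter_subset_right
  exact subset_inter subset_closure (connectedComponentIn_subset _ _)

variable {X : Type*} [TopologicalSpace X] [MeasurableSpace X] {𝒱 : Set (Set X)}
  {H : Set X → Kernel X X} {W : Set X}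
  [T2Space X] [LocallyCompactSpace X] [SecondCountableTopology X] [BorelSpace X]

/-- The harmonic measures do not charge other components. -/
lemma IsPSet.measure_compl_eq_zero_of_isOpen_diff (hH : IsNormalBauerFamily 𝒱 H)
    (hW : IsPSet 𝒱 H W) {U A V : Set X} (hUW : U ⊆ W) (hA : IsOpen A)
    (hUA : IsOpen (U \ A)) (hV : V ∈ inside 𝒱 U) {y : X} (hyV : y ∈ V) (hyA : y ∈ A) :
    H V y Aᶜ = 0 := by
  have hVo := hH.isOpen hV.1
  have := hH.isMarkovKernel hV.1
  have hfr : frontier V ⊆ U := frontier_subset_closure.trans hV.2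
  have hdiff : ∀ S : Set X, S ⊆ U → S ∩ A = S ∩ (U \ A)ᶜ := by
    intro S hS
    ext z
    simp only [mem_inter_iff, mem_compl_iff, Set.mem_sdiff, not_and, not_not]
    exact ⟨fun h => ⟨h.1, fun _ => h.2⟩, fun h => ⟨h.1, h.2 (hS h.1)⟩⟩
  obtain ⟨f, hf0, hf1, hf⟩ := exists_continuous_zero_one_of_isClosed
    (s := frontier V ∩ A) (t := frontier V ∩ Aᶜ)
    (by rw [hdiff _ hfr]; exact isClosed_frontier.inter hUA.isClosed_compl)
    (isClosed_frontier.inter hA.isClosed_compl)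
    (disjoint_compl_right.mono inter_subset_right inter_subset_right)
  have hfb : IsBoundedBorel f := isBoundedBorel_of_nonneg_of_le_one f.continuous.measurable
    (fun x => (hf x).1) fun x => (hf x).2
  have hcomp : IsCompact (closure V ∩ A) := by
    rw [hdiff _ hV.2]
    exact (hH.isCompact_closure V hV.1).inter_right hUA.isClosed_compl
  -- On the compact set `closure V ∩ A`, the function `H_V f` is harmonic inside `V` and equals `f =
  -- 0` on the part in `∂V`; hence it is `≤ 0`.
  have hle := hW.nonpos_of_submean hH hcomp (inter_subset_left.trans (hV.2.trans hUW))
    (hfb.integral_kernel (H V))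
    ((hH.continuous_apply V hV.1 f f.continuous).upperSemicontinuous.upperSemicontinuousOn _) (by
      intro z hz hpos
      have hzV : z ∈ V := by
        by_contra hzV
        rw [hH.integral_of_notMem hV.1 hzV, hf0 ⟨⟨hz.1, fun h => hzV (interior_subset h)⟩, hz.2⟩]
          at hpos
        exact lt_irrefl _ hpos
      obtain ⟨O, hO, hzO, hOVA⟩ := hH.exists_mem_closure_subset
        ((hVo.inter hA).mem_nhds ⟨hzV, hz.2⟩)
      refine ⟨O, ⟨hO, hOVA.trans (inter_subset_left.trans
        (subset_closure.trans (hV.2.trans hUW)))⟩, hzO,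
        hOVA.trans (inter_subset_inter_left _ subset_closure), ?_⟩
      exact (hH.integral_integral hO hV.1 (subset_closure.trans (hOVA.trans inter_subset_left))
        hfb z).ge)
    y ⟨subset_closure hyV, hyA⟩
  have h1 := hfb.measure_ne_eq_zero_of_integral_le
    (Eventually.of_forall fun x => (hf x).1) hle
  refine measure_mono_null ?_ (measure_union_null h1 ((hH.isBoundaryKernel V hV.1).1 y hyV))
  intro z hz
  by_cases hzf : z ∈ frontier V
  · left
    show f z ≠ 0
    rw [hf1 ⟨hzf, hz⟩]
    simp
  · exact Or.inr hzf

/-- Open subsets of `𝒫`-sets have open connected components. -/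
lemma IsPSet.isOpen_connectedComponentIn (hH : IsNormalBauerFamily 𝒱 H)
    (hW : IsPSet 𝒱 H W) {U : Set X} (hU : IsOpen U) (hUW : U ⊆ W) (x : X) :
    IsOpen (connectedComponentIn U x) := by
  by_cases hx : x ∈ U
  swap
  · rw [connectedComponentIn_eq_empty hx]
    exact isOpen_empty
  -- The intersection `Q` of `S` is the quasi-component of `x` in `U`; it is shown to be open and to
  -- be the component.
  let S : Set (Set X) := {A | A ⊆ U ∧ IsOpen A ∧ IsOpen (U \ A) ∧ x ∈ A}
  have hUS : U ∈ S := ⟨Subset.rfl, hU, by simp, hx⟩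
  set Q := ⋂₀ S with hQ
  have hQU : Q ⊆ U := sInter_subset_of_mem hUS
  have hxQ : x ∈ Q := fun A hA => hA.2.2.2
  obtain ⟨T, hTc, hTS, hTe⟩ := TopologicalSpace.isOpen_sUnion_countable
    ((fun A => U \ A) '' S) (by
      rintro _ ⟨A, hA, rfl⟩
      exact hA.2.2.1)
  have hTQ : ⋃₀ T = U \ Q := by
    rw [hTe]
    ext z
    simp only [mem_sUnion, mem_image, exists_exists_and_eq_and, Set.mem_sdiff, hQ, mem_sInter,
      not_forall]
    constructor
    · rintro ⟨A, hA, hz, hzA⟩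
      exact ⟨hz, A, hA, hzA⟩
    · rintro ⟨hz, A, hA, hzA⟩
      exact ⟨A, hA, hz, hzA⟩
  have hUQo : IsOpen (U \ Q) := by
    rw [← hTQ]
    refine isOpen_sUnion fun B hB => ?_
    obtain ⟨A, hA, rfl⟩ := hTS hB
    exact hA.2.2.1
  have hQm : MeasurableSet Q := by
    rw [← sdiff_sdiff_cancel_left hQU]
    exact hU.measurableSet.diff hUQo.measurableSet
  have hin : ∀ V ∈ inside 𝒱 U, ∀ y ∈ V, y ∈ Q → H V y Qᶜ = 0 := by
    intro V hV y hyV hyQ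
    have h1 : H V y (⋃₀ T) = 0 := by
      refine (measure_sUnion_null_iff hTc).2 fun B hB => ?_
      obtain ⟨A, hA, rfl⟩ := hTS hB
      refine measure_mono_null (fun z hz => hz.2)
        (hW.measure_compl_eq_zero_of_isOpen_diff hH hUW hA.2.1 hA.2.2.1 hV hyV (hyQ A hA))
    refine measure_mono_null ?_ (measure_union_null h1 (hH.measure_compl_eq_zero hV.1 hV.2 hyV))
    intro z hz
    by_cases hzU : z ∈ U
    · left
      rw [hTQ]
      exact ⟨hzU, hz⟩
    · exact Or.inr hzU
  have hout : ∀ V ∈ inside 𝒱 U, ∀ y ∈ V, y ∉ Q → H V y Q = 0 := by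
    intro V hV y hyV hyQ
    obtain ⟨A, hA, hyA⟩ : ∃ A ∈ S, y ∉ A := by
      simpa [hQ] using hyQ
    refine measure_mono_null (fun z hz => ?_)
      (hW.measure_compl_eq_zero_of_isOpen_diff hH hUW hA.2.2.1
        (by rw [sdiff_sdiff_cancel_left hA.1]; exact hA.2.1) hV hyV
        ⟨hV.2 (subset_closure hyV), hyA⟩)
    exact fun h => h.2 (hz A hA)
  -- The function `z ↦ H_V(z, Q)` is continuous on `V` even though `Q` is merely Borel. It is `1` on
  -- `Q` and `0` off `Q`.
  have hQo : IsOpen Q := by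
    rw [isOpen_iff_mem_nhds]
    intro y hy
    obtain ⟨V, hV, hyV, hVU⟩ := hH.exists_mem_closure_subset (hU.mem_nhds (hQU hy))
    have := hH.isMarkovKernel hV
    have hind : ∀ z, ∫ w, Q.indicator (fun _ => (1 : ℝ)) w ∂(H V z) = (H V z).real Q := by
      intro z
      rw [integral_indicator_const _ hQm]
      simp
    have hcont := hH.continuousOn_apply V hV (Q.indicator fun _ => (1 : ℝ))
      (measurable_const.indicator hQm) ⟨1, fun z => by
        by_cases h : z ∈ Q <;> simp [h]⟩
    simp only [hind] at hcont
    have hVo := hH.isOpen hV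
    have h1 : (H V y).real Q = 1 := by
      have h2 : H V y Q = 1 := by
        rw [prob_compl_eq_zero_iff hQm |>.1 (hin V ⟨hV, hVU⟩ y hyV hy)]
      simp [Measure.real, h2]
    have h3 : ∀ᶠ z in 𝓝 y, (0 : ℝ) < (H V z).real Q :=
      (hcont.continuousAt (hVo.mem_nhds hyV)).eventually
        (lt_mem_nhds (by simp only [h1]; exact one_pos))
    filter_upwards [h3, hVo.mem_nhds hyV] with z hz hzV
    by_contra hzQ
    simp [Measure.real, hout V ⟨hV, hVU⟩ z hzV hzQ] at hz
  have hQpre : IsPreconnected Q := by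
    rw [isPreconnected_iff_subset_of_disjoint]
    have key : ∀ u v : Set X, IsOpen u → IsOpen v → Q ⊆ u ∪ v → Q ∩ (u ∩ v) = ∅ → x ∈ u →
        Q ⊆ u := by
      intro u v hu hv hQuv hdis hxu
      -- As `Q` is open, a separation of `Q` would produce a smaller relatively clopen set
      -- containing `x`.
      refine fun z hz => (hz (Q ∩ u) ⟨inter_subset_left.trans hQU, hQo.inter hu, ?_, hxQ, hxu⟩).2
      have : U \ (Q ∩ u) = (U \ Q) ∪ (Q ∩ v) := by
        ext w
        constructor
        · rintro ⟨hwU, hw⟩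
          by_cases hwQ : w ∈ Q
          · exact Or.inr ⟨hwQ, (hQuv hwQ).resolve_left fun h => hw ⟨hwQ, h⟩⟩
          · exact Or.inl ⟨hwU, hwQ⟩
        · rintro (⟨h1, h2⟩ | ⟨h1, h2⟩)
          · exact ⟨h1, fun h => h2 h.1⟩
          · refine ⟨hQU h1, fun h => ?_⟩
            have : w ∈ Q ∩ (u ∩ v) := ⟨h1, h.2, h2⟩
            rw [hdis] at this
            exact this
      rw [this]
      exact hUQo.union (hQo.inter hv)
    intro u v hu hv hQuv hdis
    rcases hQuv hxQ with h | h
    · exact Or.inl (key u v hu hv hQuv hdis h)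
    · exact Or.inr (key v u hv hu (by rwa [union_comm]) (by rwa [inter_comm v u]) h)
  have hQC : Q ⊆ connectedComponentIn U x := hQpre.subset_connectedComponentIn hxQ hQU
  rw [isOpen_iff_mem_nhds]
  intro y hy
  by_cases hyQ : y ∈ Q
  · exact mem_of_superset (hQo.mem_nhds hyQ) hQC
  exfalso
  have hpre : IsPreconnected (connectedComponentIn U x) := isPreconnected_connectedComponentIn
  obtain ⟨z, hz, hz1, hz2⟩ := hpre Q (U \ Q) hQo hUQo (fun z hz => by
    by_cases hzQ : z ∈ Q
    · exact Or.inl hzQ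
    · exact Or.inr ⟨connectedComponentIn_subset _ _ hz, hzQ⟩)
    ⟨x, mem_connectedComponentIn hx, hxQ⟩ ⟨y, hy, connectedComponentIn_subset _ _ hy, hyQ⟩
  exact hz2.2 hz1

/-- In the elliptic case, a relatively closed subset of a connected open set in a `𝒫`-set which is
locally absorbing is trivial. -/
lemma IsPSet.eq_empty_or_eq_of_absorbing (hH : IsNormalBauerFamily 𝒱 H) (hell : IsElliptic 𝒱 H)
    (hW : IsPSet 𝒱 H W) {G Z : Set X} (hGc : IsPreconnected G) (hG : IsOpen G) (hGW : G ⊆ W)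
    (hGZ : IsOpen (G \ Z)) (hZG : Z ⊆ G)
    (habs : ∀ z ∈ Z, ∃ O ∈ 𝓝 z, ∀ U ∈ inside 𝒱 O, z ∈ U → H U z Zᶜ = 0) :
    Z = ∅ ∨ Z = G := by
  by_contra! hcon
  obtain ⟨⟨z₀, hz₀⟩, hne⟩ := hcon
  obtain ⟨b₀, hb₀⟩ : (G \ Z).Nonempty := by
    by_contra h
    exact hne (hZG.antisymm (sdiff_eq_empty.1 (not_nonempty_iff_eq_empty.1 h)))
  set B := connectedComponentIn (G \ Z) b₀ with hB
  have hBsub : B ⊆ G \ Z := connectedComponentIn_subset _ _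
  have hBo : IsOpen B := hW.isOpen_connectedComponentIn hH hGZ (sdiff_subset.trans hGW) b₀
  have hb₀B : b₀ ∈ B := mem_connectedComponentIn hb₀
  obtain ⟨y, ⟨hyB, hyG⟩, hyB'⟩ : ∃ y ∈ closure B ∩ G, y ∉ B := by
    by_contra! h
    exact (hBsub (hGc.subset_of_closure_inter_subset hBo ⟨b₀, hb₀.1, hb₀B⟩ h (hZG hz₀))).2 hz₀
  have hyZ : y ∈ Z := by
    by_contra hyZ
    exact hyB' (closure_connectedComponentIn_inter_subset hb₀ ⟨hyB, hyG, hyZ⟩)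
  obtain ⟨O, hO, habsO⟩ := habs y hyZ
  have hyb : y ≠ b₀ := fun h => hyB' (h ▸ hb₀B)
  obtain ⟨U, hU, hyU, hUsub⟩ := hH.exists_mem_closure_subset
    (inter_mem hO (inter_mem (hG.mem_nhds hyG) (isOpen_ne.mem_nhds hyb)))
  have hUo := hH.isOpen hU
  have := hH.isMarkovKernel hU
  have hUG : closure U ⊆ G := fun z hz => (hUsub hz).2.1
  set G' := connectedComponentIn U y with hG'
  have hG'U : G' ⊆ U := connectedComponentIn_subset _ _
  have hG'o : IsOpen G' := hW.isOpen_connectedComponentIn hH hUo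
    (subset_closure.trans (hUG.trans hGW)) y
  have hyG' : y ∈ G' := mem_connectedComponentIn hyU
  -- The connected set `B` meets `G'` but is not contained in it, because `b₀ ∉ U`; so it meets the
  -- boundary of `G'`.
  obtain ⟨b, ⟨hbG', hbB⟩, hbn⟩ : ∃ b ∈ closure G' ∩ B, b ∉ G' := by
    by_contra! h
    obtain ⟨q, hq, hqB⟩ := mem_closure_iff.1 hyB G' hG'o hyG'
    have hpre : IsPreconnected B := isPreconnected_connectedComponentIn
    have h1 := hpre.subset_of_closure_inter_subset hG'o ⟨q, hqB, hq⟩ h hb₀B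
    exact (hUsub (subset_closure (hG'U h1))).2.2 rfl
  have hbU : b ∉ U := fun h => hbn (closure_connectedComponentIn_inter_subset hyU ⟨hbG', h⟩)
  -- `H_U f ≥ 0` is harmonic on `G'`. It vanishes at `y`, where the measure is carried by `Z`, and
  -- is positive near `b`, contradicting ellipticity.
  obtain ⟨f, hf0, hf1, hf⟩ := exists_continuous_zero_one_of_isClosed
    (s := (G \ Z)ᶜ) (t := {b}) hGZ.isClosed_compl isClosed_singleton
    (disjoint_singleton_right.2 fun h => h (hBsub hbB))
  have hfb : IsBoundedBorel f := isBoundedBorel_of_nonneg_of_le_one f.continuous.measurable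
    (fun x => (hf x).1) fun x => (hf x).2
  have hcont := hH.continuous_apply U hU f f.continuous
  have hval : ∫ z, f z ∂(H U b) = 1 := by
    rw [hH.integral_of_notMem hU hbU, hf1 rfl, Pi.one_apply]
  obtain ⟨q, hq, hqG'⟩ := mem_closure_iff.1 hbG' {z | 0 < ∫ w, f w ∂(H U z)}
    (isOpen_lt continuous_const hcont) (by simp [hval])
  have hharm : IsHarmonic 𝒱 H G' (fun z => ∫ w, f w ∂(H U z)) :=
    ⟨hcont.continuousOn, fun V hV z hz => hH.integral_integral hV.1 hU
      (subset_closure.trans (hV.2.trans hG'U)) hfb z⟩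
  have hzero : ∫ w, f w ∂(H U y) = 0 := by
    refine integral_eq_zero_of_ae ?_
    have : ∀ᵐ w ∂(H U y), w ∈ Z :=
      ae_iff.2 (habsO U ⟨hU, fun z hz => (hUsub hz).1⟩ hyU)
    exact this.mono fun w hw => hf0 fun h => h.2 hw
  rcases hell G' hG'o ⟨⟨y, hyG'⟩, isPreconnected_connectedComponentIn⟩ _ hharm
    (fun z _ => integral_nonneg fun w => (hf w).1) with h | h
  · exact (h q hqG').not_gt hq
  · exact (h y hyG').ne' hzero

end BauerFamily

/-! ### Smallest supermean majorants by iteration -/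

namespace BauerFamily

section Definitions

variable {X : Type*} [MeasurableSpace X]

/-- Successive maxima of `φ` and its images under the kernels `H (e i)`, each of which is applied
infinitely often. -/
noncomputable def reduceSeq (H : Set X → Kernel X X) (e : ℕ → Set X) (φ : X → ℝ) : ℕ → X → ℝ
  | 0 => φ
  | n + 1 => fun x => max (reduceSeq H e φ n x)
      (∫ y, reduceSeq H e φ n y ∂(H (e (Nat.unpair n).1) x))

/-- The reduced function of `φ` with respect to the kernels `H (e i)`. -/
noncomputable def reduced (H : Set X → Kernel X X) (e : ℕ → Set X) (φ : X → ℝ) (x : X) : ℝ :=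
  ⨆ n, reduceSeq H e φ n x

lemma monotone_reduceSeq (H : Set X → Kernel X X) (e : ℕ → Set X) (φ : X → ℝ) (x : X) :
    Monotone fun n => reduceSeq H e φ n x :=
  monotone_nat_of_le_succ fun _ => le_max_left _ _

end Definitions

variable {X : Type*} [TopologicalSpace X] [MeasurableSpace X] {𝒱 : Set (Set X)}
  {H : Set X → Kernel X X} {W : Set X}

section Sequence

variable {e : ℕ → Set X} {φ : X → ℝ}

lemma continuous_reduceSeq (hH : IsNormalBauerFamily 𝒱 H) (he : ∀ i, e i ∈ inside 𝒱 W)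
    (hφ : Continuous φ) (n : ℕ) : Continuous (reduceSeq H e φ n) := by
  induction n with
  | zero => exact hφ
  | succ n ih => exact ih.max (hH.continuous_apply _ (he _).1 _ ih)

variable [BorelSpace X]

lemma reduceSeq_mem_Icc (hH : IsNormalBauerFamily 𝒱 H) (he : ∀ i, e i ∈ inside 𝒱 W)
    (hφ : Continuous φ) (h01 : ∀ x, φ x ∈ Icc (0 : ℝ) 1) (n : ℕ) (x : X) :
    reduceSeq H e φ n x ∈ Icc (0 : ℝ) 1 := by
  induction n generalizing x with
  | zero => exact h01 x
  | succ n ih =>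
    have := hH.isMarkovKernel (he (Nat.unpair n).1).1
    have hb : IsBoundedBorel (reduceSeq H e φ n) := isBoundedBorel_of_nonneg_of_le_one
      (continuous_reduceSeq hH he hφ n).measurable (fun x => (ih x).1) fun x => (ih x).2
    refine ⟨(ih x).1.trans (le_max_left _ _), max_le (ih x).2 ?_⟩
    refine (integral_mono (hb.integrable _) (integrable_const 1) fun y => (ih y).2).trans ?_
    simp

lemma isBoundedBorel_reduceSeq (hH : IsNormalBauerFamily 𝒱 H) (he : ∀ i, e i ∈ inside 𝒱 W)
    (hφ : Continuous φ) (h01 : ∀ x, φ x ∈ Icc (0 : ℝ) 1) (n : ℕ) :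
    IsBoundedBorel (reduceSeq H e φ n) :=
  isBoundedBorel_of_nonneg_of_le_one (continuous_reduceSeq hH he hφ n).measurable
    (fun x => (reduceSeq_mem_Icc hH he hφ h01 n x).1)
    fun x => (reduceSeq_mem_Icc hH he hφ h01 n x).2

lemma bddAbove_reduceSeq (hH : IsNormalBauerFamily 𝒱 H) (he : ∀ i, e i ∈ inside 𝒱 W)
    (hφ : Continuous φ) (h01 : ∀ x, φ x ∈ Icc (0 : ℝ) 1) (x : X) :
    BddAbove (range fun n => reduceSeq H e φ n x) :=
  ⟨1, by rintro _ ⟨n, rfl⟩; exact (reduceSeq_mem_Icc hH he hφ h01 n x).2⟩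

lemma reduceSeq_le_reduced (hH : IsNormalBauerFamily 𝒱 H) (he : ∀ i, e i ∈ inside 𝒱 W)
    (hφ : Continuous φ) (h01 : ∀ x, φ x ∈ Icc (0 : ℝ) 1) (n : ℕ) (x : X) :
    reduceSeq H e φ n x ≤ reduced H e φ x :=
  le_ciSup (bddAbove_reduceSeq hH he hφ h01 x) n

lemma reduced_mem_Icc (hH : IsNormalBauerFamily 𝒱 H) (he : ∀ i, e i ∈ inside 𝒱 W)
    (hφ : Continuous φ) (h01 : ∀ x, φ x ∈ Icc (0 : ℝ) 1) (x : X) :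
    reduced H e φ x ∈ Icc (0 : ℝ) 1 :=
  ⟨(h01 x).1.trans (reduceSeq_le_reduced hH he hφ h01 0 x),
    ciSup_le fun n => (reduceSeq_mem_Icc hH he hφ h01 n x).2⟩

lemma lowerSemicontinuous_reduced (hH : IsNormalBauerFamily 𝒱 H) (he : ∀ i, e i ∈ inside 𝒱 W)
    (hφ : Continuous φ) (h01 : ∀ x, φ x ∈ Icc (0 : ℝ) 1) :
    LowerSemicontinuous (reduced H e φ) :=
  lowerSemicontinuous_ciSup (bddAbove_reduceSeq hH he hφ h01) fun n =>
    (continuous_reduceSeq hH he hφ n).lowerSemicontinuous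

lemma isBoundedBorel_reduced (hH : IsNormalBauerFamily 𝒱 H) (he : ∀ i, e i ∈ inside 𝒱 W)
    (hφ : Continuous φ) (h01 : ∀ x, φ x ∈ Icc (0 : ℝ) 1) : IsBoundedBorel (reduced H e φ) :=
  isBoundedBorel_of_nonneg_of_le_one (lowerSemicontinuous_reduced hH he hφ h01).measurable
    (fun x => (reduced_mem_Icc hH he hφ h01 x).1) fun x => (reduced_mem_Icc hH he hφ h01 x).2

lemma tendsto_integral_reduceSeq (hH : IsNormalBauerFamily 𝒱 H) (he : ∀ i, e i ∈ inside 𝒱 W)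
    (hφ : Continuous φ) (h01 : ∀ x, φ x ∈ Icc (0 : ℝ) 1) (μ : Measure X) [IsFiniteMeasure μ] :
    Tendsto (fun n => ∫ y, reduceSeq H e φ n y ∂μ) atTop (𝓝 (∫ y, reduced H e φ y ∂μ)) := by
  refine integral_tendsto_of_tendsto_of_monotone
    (fun n => (isBoundedBorel_reduceSeq hH he hφ h01 n).integrable μ)
    ((isBoundedBorel_reduced hH he hφ h01).integrable μ)
    (Eventually.of_forall fun y => monotone_reduceSeq H e φ y)
    (Eventually.of_forall fun y => ?_)
  exact tendsto_atTop_ciSup (monotone_reduceSeq H e φ y) (bddAbove_reduceSeq hH he hφ h01 y)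

/-- The kernel of `e i` is applied at every step `Nat.pair i k ≥ k`; monotone convergence along
these steps gives the inequality. -/
lemma integral_reduced_le_of_index (hH : IsNormalBauerFamily 𝒱 H) (he : ∀ i, e i ∈ inside 𝒱 W)
    (hφ : Continuous φ) (h01 : ∀ x, φ x ∈ Icc (0 : ℝ) 1) (i : ℕ) (x : X) :
    ∫ y, reduced H e φ y ∂(H (e i) x) ≤ reduced H e φ x := by
  have := hH.isMarkovKernel (he i).1
  have ht := (tendsto_integral_reduceSeq hH he hφ h01 (H (e i) x)).comp
    (tendsto_atTop_mono (fun k => Nat.right_le_pair i k) tendsto_id)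
  refine le_of_tendsto' ht fun k => ?_
  refine le_trans ?_ (reduceSeq_le_reduced hH he hφ h01 (Nat.pair i k + 1) x)
  have : ∫ y, reduceSeq H e φ (Nat.pair i k) y ∂(H (e (Nat.unpair (Nat.pair i k)).1) x) ≤
      reduceSeq H e φ (Nat.pair i k + 1) x := le_max_right _ _
  simpa using this

/-- The reduced function is the smallest supermean majorant. -/
lemma mul_reduced_le (hH : IsNormalBauerFamily 𝒱 H) (he : ∀ i, e i ∈ inside 𝒱 W)
    (hφ : Continuous φ) (h01 : ∀ x, φ x ∈ Icc (0 : ℝ) 1) [T2Space X] {f : X → ℝ}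
    (hf : IsBoundedSupermean 𝒱 H W f) {t : ℝ} (ht : 0 ≤ t) (hle : ∀ x, t * φ x ≤ f x) (x : X)
    (hx : x ∈ W) : t * reduced H e φ x ≤ f x := by
  have key : ∀ n, ∀ x ∈ W, t * reduceSeq H e φ n x ≤ f x := by
    intro n
    induction n with
    | zero => exact fun x _ => hle x
    | succ n ih =>
      intro x hx
      have hn := he (Nat.unpair n).1
      have := hH.isMarkovKernel hn.1
      simp only [reduceSeq]
      rw [mul_max_of_nonneg _ _ ht]
      refine max_le (ih x hx) ?_
      by_cases hxe : x ∈ e (Nat.unpair n).1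
      · rw [← integral_const_mul]
        refine le_trans ?_ (hf.integral_le _ hn x hxe)
        refine integral_mono_ae
          (((isBoundedBorel_reduceSeq hH he hφ h01 n).integrable _).const_mul t)
          (hf.isBoundedBorel.integrable _) ?_
        exact (hH.ae_mem hn.1 hn.2 hxe).mono fun y hy => ih y hy
      · rw [hH.integral_of_notMem hn.1 hxe]
        exact ih x hx
  rw [reduced, Real.mul_iSup_of_nonneg ht]
  exact ciSup_le fun n => key n x hx

variable [T2Space X]

/-- Off the support of `φ`, the approximating functions are locally submean. -/
lemma exists_nhds_reduceSeq_le_integral (hH : IsNormalBauerFamily 𝒱 H)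
    (he : ∀ i, e i ∈ inside 𝒱 W) (hφ : Continuous φ) (h01 : ∀ x, φ x ∈ Icc (0 : ℝ) 1)
    {y : X} (hy : φ y = 0) (n : ℕ) :
    ∃ O ∈ 𝓝 y, ∀ U ∈ 𝒱, y ∈ U → U ⊆ O →
      reduceSeq H e φ n y ≤ ∫ z, reduceSeq H e φ n z ∂(H U y) := by
  induction n with
  | zero =>
    refine ⟨univ, univ_mem, fun U _ _ _ => ?_⟩
    rw [reduceSeq, hy]
    exact integral_nonneg fun z => (h01 z).1
  | succ n ih =>
    have hn := he (Nat.unpair n).1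
    have := hH.isMarkovKernel hn.1
    have hb := isBoundedBorel_reduceSeq hH he hφ h01 n
    have hb' := isBoundedBorel_reduceSeq hH he hφ h01 (n + 1)
    rcases le_or_gt (∫ z, reduceSeq H e φ n z ∂(H (e (Nat.unpair n).1) y))
      (reduceSeq H e φ n y) with h | h
    · obtain ⟨O, hO, hOU⟩ := ih
      refine ⟨O, hO, fun U hU hyU hUO => ?_⟩
      have := hH.isMarkovKernel hU
      have hval : reduceSeq H e φ (n + 1) y = reduceSeq H e φ n y := max_eq_left h
      rw [hval]
      refine (hOU U hU hyU hUO).trans (integral_mono (hb.integrable _) (hb'.integrable _)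
        fun z => monotone_reduceSeq H e φ z n.le_succ)
    -- Here the new value comes from `H_{e i}` of the previous function, which is harmonic inside `e
    -- i` and everywhere below the new function.
    · have hye : y ∈ e (Nat.unpair n).1 := by
        by_contra hye
        rw [hH.integral_of_notMem hn.1 hye] at h
        exact lt_irrefl _ h
      refine ⟨_, (hH.isOpen hn.1).mem_nhds hye, fun U hU hyU hUO => ?_⟩
      have := hH.isMarkovKernel hU
      have hval : reduceSeq H e φ (n + 1) y =
        ∫ z, reduceSeq H e φ n z ∂(H (e (Nat.unpair n).1) y) := max_eq_right h.le
      rw [hval, ← hH.integral_integral hU hn.1 hUO hb]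
      exact integral_mono ((hb.integral_kernel _).integrable _) (hb'.integrable _)
        fun z => le_max_right _ _

variable [SecondCountableTopology X]

/-- The iteration only tests the sets `e i`. Since they form a base, the maximum principle for `H_U`
of an approximant minus the reduced function extends the inequality to all `U ∈ 𝒱(W)`. -/
lemma integral_reduced_le (hH : IsNormalBauerFamily 𝒱 H) (hW : IsPSet 𝒱 H W)
    (he : ∀ i, e i ∈ inside 𝒱 W)
    (hbase : ∀ y ∈ W, ∀ O ∈ 𝓝 y, ∃ i, y ∈ e i ∧ closure (e i) ⊆ O)
    (hφ : Continuous φ) (h01 : ∀ x, φ x ∈ Icc (0 : ℝ) 1) {U : Set X} (hU : U ∈ inside 𝒱 W)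
    {y : X} (hy : y ∈ U) : ∫ z, reduced H e φ z ∂(H U y) ≤ reduced H e φ y := by
  have := hH.isMarkovKernel hU.1
  refine le_of_tendsto' (tendsto_integral_reduceSeq hH he hφ h01 (H U y)) fun n => ?_
  have hb := isBoundedBorel_reduceSeq hH he hφ h01 n
  have hc := continuous_reduceSeq hH he hφ n
  have hbr := isBoundedBorel_reduced hH he hφ h01
  have husc : UpperSemicontinuous fun z => -reduced H e φ z := by
    intro z a ha
    filter_upwards [lowerSemicontinuous_reduced hH he hφ h01 z (-a) (by linarith)] with w hw
    linarith
  refine sub_nonpos.1 (hW.nonpos_of_submean hH (hH.isCompact_closure U hU.1)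
    hU.2 ((hb.integral_kernel (H U)).sub hbr) ?_ ?_ y (subset_closure hy))
  · simp only [sub_eq_add_neg]
    exact ((hH.continuous_apply U hU.1 _ hc).upperSemicontinuous.add husc).upperSemicontinuousOn _
  intro z hz hpos
  have hzU : z ∈ U := by
    by_contra hzU
    rw [hH.integral_of_notMem hU.1 hzU] at hpos
    exact hpos.not_ge (sub_nonpos.2 (reduceSeq_le_reduced hH he hφ h01 n z))
  obtain ⟨i, hzi, hiU⟩ := hbase z (hU.2 hz) U ((hH.isOpen hU.1).mem_nhds hzU)
  have := hH.isMarkovKernel (he i).1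
  refine ⟨e i, he i, hzi, hiU.trans subset_closure, ?_⟩
  rw [integral_sub ((hb.integral_kernel _).integrable _) (hbr.integrable _),
    hH.integral_integral (he i).1 hU.1 (subset_closure.trans hiU) hb]
  exact sub_le_sub_left (integral_reduced_le_of_index hH he hφ h01 i z) _

variable [LocallyCompactSpace X]

/-- The maximum principle turns the local submean property off `C` into a global one. In the limit
it yields the half of harmonicity opposite to `integral_reduced_le`. -/
lemma reduceSeq_le_integral (hH : IsNormalBauerFamily 𝒱 H) (hW : IsPSet 𝒱 H W)
    (he : ∀ i, e i ∈ inside 𝒱 W) (hφ : Continuous φ) (h01 : ∀ x, φ x ∈ Icc (0 : ℝ) 1)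
    {C U : Set X} (hφC : ∀ x ∉ C, φ x = 0) (hU : U ∈ inside 𝒱 (W \ C)) (n : ℕ) {y : X}
    (hy : y ∈ U) : reduceSeq H e φ n y ≤ ∫ z, reduceSeq H e φ n z ∂(H U y) := by
  have := hH.isMarkovKernel hU.1
  have hb := isBoundedBorel_reduceSeq hH he hφ h01 n
  have hc := continuous_reduceSeq hH he hφ n
  refine sub_nonpos.1 (hW.nonpos_of_submean hH (hH.isCompact_closure U hU.1)
    (hU.2.trans sdiff_subset) (hb.sub (hb.integral_kernel (H U)))
    ((hc.sub (hH.continuous_apply U hU.1 _ hc)).upperSemicontinuous.upperSemicontinuousOn _) ?_ y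
    (subset_closure hy))
  intro z hz hpos
  have hzU : z ∈ U := by
    by_contra hzU
    rw [hH.integral_of_notMem hU.1 hzU, sub_self] at hpos
    exact lt_irrefl _ hpos
  obtain ⟨O, hO, hOle⟩ := exists_nhds_reduceSeq_le_integral hH he hφ h01
    (hφC z (hU.2 hz).2) n
  obtain ⟨V, hV, hzV, hVO⟩ := hH.exists_mem_closure_subset
    (inter_mem hO ((hH.isOpen hU.1).mem_nhds hzU))
  have := hH.isMarkovKernel hV
  have hVU : closure V ⊆ U := hVO.trans inter_subset_right
  refine ⟨V, ⟨hV, hVU.trans (subset_closure.trans (hU.2.trans sdiff_subset))⟩, hzV,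
    hVU.trans subset_closure, ?_⟩
  rw [integral_sub (hb.integrable _) ((hb.integral_kernel _).integrable _),
    hH.integral_integral hV hU.1 (subset_closure.trans hVU) hb]
  exact sub_le_sub_right (hOle V hV hzV (subset_closure.trans (hVO.trans inter_subset_left))) _

end Sequence

variable [T2Space X] [LocallyCompactSpace X] [SecondCountableTopology X]

lemma IsNormalBauerFamily.exists_seq_base (hH : IsNormalBauerFamily 𝒱 H) (hWo : IsOpen W)
    (hWne : W.Nonempty) :
    ∃ e : ℕ → Set X, (∀ i, e i ∈ inside 𝒱 W) ∧
      ∀ y ∈ W, ∀ O ∈ 𝓝 y, ∃ i, y ∈ e i ∧ closure (e i) ⊆ O := by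
  obtain ⟨B, hB𝒱, hBc, hB⟩ := hH.isBasis.exists_countable
  have hsmall : ∀ y ∈ W, ∀ O ∈ 𝓝 y, ∃ U ∈ {U ∈ B | closure U ⊆ W}, y ∈ U ∧ closure U ⊆ O := by
    intro y hy O hO
    obtain ⟨F, hF, hFc, hFO⟩ := exists_mem_nhds_isClosed_subset
      (inter_mem hO (hWo.mem_nhds hy))
    obtain ⟨U, hU, hyU, hUF⟩ := hB.mem_nhds_iff.1 hF
    have := (closure_minimal hUF hFc).trans hFO
    exact ⟨U, ⟨hU, this.trans inter_subset_right⟩, hyU, this.trans inter_subset_left⟩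
  obtain ⟨x, hx⟩ := hWne
  obtain ⟨U, hU, -⟩ := hsmall x hx univ univ_mem
  obtain ⟨e, he⟩ := (hBc.mono (sep_subset B fun U => closure U ⊆ W)).exists_eq_range ⟨U, hU⟩
  refine ⟨e, fun i => ?_, fun y hy O hO => ?_⟩
  · have : e i ∈ {U ∈ B | closure U ⊆ W} := he ▸ mem_range_self i
    exact ⟨hB𝒱 this.1, this.2⟩
  · obtain ⟨U, hU, h⟩ := hsmall y hy O hO
    rw [he] at hU
    obtain ⟨i, rfl⟩ := hU
    exact ⟨i, h⟩

variable [BorelSpace X]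

/-- Every continuous function `φ` with values in `[0, 1]` has a smallest supermean majorant on a
`𝒫`-set, and it is harmonic off the support of `φ`. -/
lemma IsPSet.exists_reduced (hH : IsNormalBauerFamily 𝒱 H) (hW : IsPSet 𝒱 H W)
    (hWne : W.Nonempty) {φ : X → ℝ} (hφ : Continuous φ) (h01 : ∀ x, φ x ∈ Icc (0 : ℝ) 1)
    {C : Set X} (hC : IsClosed C) (hφC : ∀ x ∉ C, φ x = 0) :
    ∃ w : X → ℝ, IsBoundedSupermean 𝒱 H W w ∧ (∀ x, w x ≤ 1) ∧ (∀ x, φ x ≤ w x) ∧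
      IsHarmonic 𝒱 H (W \ C) w ∧
      ∀ f, IsBoundedSupermean 𝒱 H W f → ∀ t, 0 ≤ t → (∀ x, t * φ x ≤ f x) →
        ∀ x ∈ W, t * w x ≤ f x := by
  obtain ⟨e, he, hbase⟩ := hH.exists_seq_base hW.1 hWne
  have hbr := isBoundedBorel_reduced hH he hφ h01
  have hmean : ∀ U ∈ inside 𝒱 (W \ C), ∀ y ∈ U,
      ∫ z, reduced H e φ z ∂(H U y) = reduced H e φ y := by
    intro U hU y hy
    have := hH.isMarkovKernel hU.1
    refine le_antisymm (integral_reduced_le hH hW he hbase hφ h01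
      ⟨hU.1, hU.2.trans sdiff_subset⟩ hy) ?_
    exact ciSup_le fun n => (reduceSeq_le_integral hH hW he hφ h01 hφC hU n hy).trans
      (integral_mono ((isBoundedBorel_reduceSeq hH he hφ h01 n).integrable _)
        (hbr.integrable _) fun z => reduceSeq_le_reduced hH he hφ h01 n z)
  refine ⟨reduced H e φ, ⟨(lowerSemicontinuous_reduced hH he hφ h01).lowerSemicontinuousOn _, hbr,
    fun x => (reduced_mem_Icc hH he hφ h01 x).1,
    fun U hU x hx => integral_reduced_le hH hW he hbase hφ h01 hU hx⟩,
    fun x => (reduced_mem_Icc hH he hφ h01 x).2,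
    fun x => reduceSeq_le_reduced hH he hφ h01 0 x, ⟨?_, hmean⟩,
    fun f hf t ht hle x hx => mul_reduced_le hH he hφ h01 hf ht hle x hx⟩
  intro y hy
  obtain ⟨U, hU, hyU, hUW⟩ := hH.exists_mem_closure_subset
    ((hW.1.sdiff hC).mem_nhds hy)
  have hUy := (hH.isOpen hU).mem_nhds hyU
  refine ContinuousAt.continuousWithinAt ?_
  -- Near `y` the function equals its own `H_U`-image, which is continuous on `U` for any bounded
  -- Borel function.
  refine ((hH.continuousOn_apply U hU _ hbr.1 hbr.2).continuousAt hUy).congr ?_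
  filter_upwards [hUy] with z hz using hmean U ⟨hU, hUW⟩ z hz

end BauerFamily

/-! ### Harmonic functions and regularity -/

namespace BauerFamily

lemma eintegral_coe_eq_integral {X : Type*} [MeasurableSpace X] {μ : Measure X} {h : X → ℝ} (hh : Integrable h μ) :
    eintegral μ (fun x => (h x : EReal)) = ((∫ y, h y ∂μ : ℝ) : EReal) := by
  have h1 : ∀ a : ℝ, (a : EReal).toENNReal = ENNReal.ofReal a := fun a => by simp
  have h2 : ∀ a : ℝ, (-(a : EReal)).toENNReal = ENNReal.ofReal (-a) := fun a => by
    rw [← EReal.coe_neg, h1]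
  have hneg : ∫⁻ y, ENNReal.ofReal (-h y) ∂μ < ⊤ := hh.neg.lintegral_lt_top
  rw [integral_eq_lintegral_pos_part_sub_lintegral_neg_part hh, EReal.coe_sub,
    EReal.coe_ennreal_toReal hh.lintegral_lt_top.ne, EReal.coe_ennreal_toReal hneg.ne]
  simp only [eintegral, h1, h2]

variable {X : Type*} [TopologicalSpace X] [MeasurableSpace X] {𝒱 : Set (Set X)}
  {H : Set X → Kernel X X} {W : Set X}

lemma IsHarmonic.mono {U U' : Set X} {h : X → ℝ} (hh : IsHarmonic 𝒱 H U h) (hU : U' ⊆ U) :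
    IsHarmonic 𝒱 H U' h :=
  ⟨hh.1.mono hU, fun V hV => hh.2 V ⟨hV.1, hV.2.trans hU⟩⟩

lemma IsBoundedSupermean.mono {U : Set X} {f : X → ℝ} (hf : IsBoundedSupermean 𝒱 H W f)
    (hU : U ⊆ W) : IsBoundedSupermean 𝒱 H U f :=
  ⟨hf.1.mono hU, hf.2, hf.3, fun V hV => hf.4 V ⟨hV.1, hV.2.trans hU⟩⟩

variable [T2Space X]

/-- An isolated point would be a member of `𝒱` with empty boundary, which cannot carry a measure of
mass one. -/
lemma IsNormalBauerFamily.not_isOpen_singleton (hH : IsNormalBauerFamily 𝒱 H) (x : X) :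
    ¬ IsOpen ({x} : Set X) := by
  intro hx
  obtain ⟨V, hV, hxV, hVx⟩ := hH.isBasis.mem_nhds_iff.1 (hx.mem_nhds rfl)
  have hVeq : V = {x} := hVx.antisymm (singleton_subset_iff.2 hxV)
  have h1 := (hH.isBoundaryKernel V hV).1 x hxV
  have hfr : frontier V = ∅ := by
    rw [hVeq]
    exact IsClopen.frontier_eq ⟨isClosed_singleton, hx⟩
  rw [hfr, compl_empty, hH.apply_univ V hV] at h1
  exact one_ne_zero h1

variable [BorelSpace X]

lemma IsHarmonic.integrable (hH : IsNormalBauerFamily 𝒱 H) {U : Set X} {h : X → ℝ}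
    (hh : IsHarmonic 𝒱 H U h) {V : Set X} (hV : V ∈ inside 𝒱 U) {x : X} (hx : x ∈ V) :
    Integrable h (H V x) := by
  have := hH.isMarkovKernel hV.1
  have hcomp : IsCompact (frontier V) :=
    (hH.isCompact_closure V hV.1).of_isClosed_subset isClosed_frontier frontier_subset_closure
  have h1 := (hh.1.mono (frontier_subset_closure.trans hV.2)).integrableOn_compact (μ := H V x)
    hcomp
  rwa [IntegrableOn, Measure.restrict_eq_self_of_ae_mem (hH.ae_mem_frontier hV.1 hx)] at h1

lemma IsHarmonic.isSuperharmonic (hH : IsNormalBauerFamily 𝒱 H) {U : Set X} (hU : IsOpen U)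
    {h : X → ℝ} (hh : IsHarmonic 𝒱 H U h) :
    IsSuperharmonic 𝒱 H U (fun x => (h x : EReal)) := by
  have key : ∀ V ∈ inside 𝒱 U, ∀ x ∈ V, eintegral (H V x) (fun x => (h x : EReal)) = h x :=
    fun V hV x hx => by rw [eintegral_coe_eq_integral (hh.integrable hH hV hx), hh.2 V hV x hx]
  refine ⟨⟨?_, fun x _ => EReal.coe_ne_bot _, fun x _ V hV => (key V hV.1 x hV.2).le⟩, ?_⟩
  · exact (continuous_coe_real_ereal.comp_continuousOn hh.1).lowerSemicontinuousOn
  · intro V hV x hx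
    have hc : ContinuousAt (fun y => |h y|) x :=
      (hh.1.continuousAt (hU.mem_nhds (hV.2 (subset_closure hx)))).abs
    refine ⟨|h x| + 1, ?_⟩
    filter_upwards [self_mem_nhdsWithin,
      nhdsWithin_le_nhds (hc.eventually (gt_mem_nhds (lt_add_one |h x|)))] with y hy hlt
    rw [key V hV y hy, EReal.coe_le_coe_iff, EReal.coe_le_coe_iff]
    exact abs_le.1 hlt.le

/-- Members of `𝒱` are regular. -/
lemma IsNormalBauerFamily.continuousOn_closure_integral [NormalSpace X]
    (hH : IsNormalBauerFamily 𝒱 H) {V : Set X} (hV : V ∈ 𝒱) {w : X → ℝ}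
    (hw : ContinuousOn w (frontier V)) :
    ContinuousOn (fun x => ∫ y, w y ∂(H V x)) (closure V) := by
  obtain ⟨f, hf⟩ := ContinuousMap.exists_restrict_eq (isClosed_frontier (s := V))
    (⟨(frontier V).domRestrict w, hw.domRestrict⟩ : C(frontier V, ℝ))
  have hfw : ∀ y ∈ frontier V, f y = w y := fun y hy => congrArg (fun g => g ⟨y, hy⟩) hf
  refine (hH.continuous_apply V hV f f.continuous).continuousOn.congr fun x hx => ?_
  by_cases hxV : x ∈ V
  · exact integral_congr_ae ((hH.ae_mem_frontier hV hxV).mono fun y hy => (hfw y hy).symm)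
  · show _ = ∫ y, f y ∂(H V x)
    rw [hH.integral_of_notMem hV hxV, hH.integral_of_notMem hV hxV, hfw x
      ⟨hx, fun h => hxV (interior_subset h)⟩]

/-! ### Minimum principle, potentials and strongly stable neighborhoods -/

variable [LocallyCompactSpace X] [SecondCountableTopology X]

/-- A bounded supermean function `w` which equals `1` at some point of a connected open set `G` and
is locally harmonic on `G` equals `1` on `G`. -/
lemma IsPSet.eq_one_of_harmonic (hH : IsNormalBauerFamily 𝒱 H) (hell : IsElliptic 𝒱 H)
    (hW : IsPSet 𝒱 H W) {G : Set X} (hGc : IsPreconnected G) (hG : IsOpen G) (hGW : G ⊆ W)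
    {w : X → ℝ} (hwb : IsBoundedBorel w) (hw1 : ∀ x, w x ≤ 1) (hwc : ContinuousOn w G)
    (hloc : ∀ z ∈ G, ∃ O ∈ 𝓝 z, ∀ U ∈ inside 𝒱 O, z ∈ U → ∫ y, w y ∂(H U z) = w z)
    {x : X} (hx : x ∈ G) (hwx : w x = 1) : ∀ y ∈ G, w y = 1 := by
  have hset : G \ {z ∈ G | w z = 1} = G ∩ w ⁻¹' Iio 1 := by
    ext z
    refine ⟨fun h => ⟨h.1, lt_of_le_of_ne (hw1 z) fun h' => h.2 ⟨h.1, h'⟩⟩,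
      fun h => ⟨h.1, fun h' => h.2.ne h'.2⟩⟩
  rcases hW.eq_empty_or_eq_of_absorbing hH hell (Z := {z ∈ G | w z = 1}) hGc hG hGW
    (by rw [hset]; exact hwc.isOpen_inter_preimage hG isOpen_Iio) (sep_subset _ _) (by
      rintro z ⟨hzG, hz⟩
      obtain ⟨O, hO, hOw⟩ := hloc z hzG
      refine ⟨O ∩ G, inter_mem hO (hG.mem_nhds hzG), fun U hU hzU => ?_⟩
      have := hH.isMarkovKernel hU.1
      have h1 := hwb.measure_ne_eq_zero_of_le_integral (μ := H U z)
        (Eventually.of_forall hw1)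
        (by rw [hOw U ⟨hU.1, hU.2.trans inter_subset_left⟩ hzU, hz])
      refine measure_mono_null ?_ (measure_union_null h1
        (hH.measure_compl_eq_zero hU.1 (hU.2.trans inter_subset_right) hzU))
      intro y hy
      by_cases hyG : y ∈ G
      · exact Or.inl fun h => hy ⟨hyG, h⟩
      · exact Or.inr hyG) with h | h
  · exact absurd (show x ∈ {z ∈ G | w z = 1} from ⟨hx, hwx⟩) (by rw [h]; exact id)
  · exact fun y hy => (h.symm.subset hy).2

/-- A bounded supermean function attaining its minimum over a connected open set is constant. -/
lemma IsBoundedSupermean.eq_of_isMinOn (hH : IsNormalBauerFamily 𝒱 H) (hell : IsElliptic 𝒱 H)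
    (hW : IsPSet 𝒱 H W) {G : Set X} (hGc : IsPreconnected G) (hG : IsOpen G) (hGW : G ⊆ W)
    {f : X → ℝ} (hf : IsBoundedSupermean 𝒱 H G f) {x : X} (hx : x ∈ G)
    (hmin : ∀ y ∈ G, f x ≤ f y) : ∀ y ∈ G, f y = f x := by
  have hset : G \ {z ∈ G | f z = f x} = G ∩ f ⁻¹' Ioi (f x) := by
    ext z
    refine ⟨fun h => ⟨h.1, lt_of_le_of_ne (hmin z h.1) fun h' => h.2 ⟨h.1, h'.symm⟩⟩,
      fun h => ⟨h.1, fun h' => h.2.ne' h'.2⟩⟩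
  have hopen : IsOpen (G ∩ f ⁻¹' Ioi (f x)) := by
    rw [isOpen_iff_mem_nhds]
    rintro y ⟨hyG, hy⟩
    have := hf.lowerSemicontinuousOn y hyG _ hy
    rw [hG.nhdsWithin_eq hyG] at this
    exact inter_mem (hG.mem_nhds hyG) this
  rcases hW.eq_empty_or_eq_of_absorbing hH hell (Z := {z ∈ G | f z = f x}) hGc hG hGW
    (by rwa [hset]) (sep_subset _ _) (by
      rintro z ⟨hzG, hz⟩
      refine ⟨G, hG.mem_nhds hzG, fun U hU hzU => ?_⟩
      have := hH.isMarkovKernel hU.1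
      have h1 := hf.isBoundedBorel.measure_ne_eq_zero_of_integral_le (μ := H U z)
        ((hH.ae_mem hU.1 hU.2 hzU).mono hmin)
        ((hf.integral_le U hU z hzU).trans hz.le)
      refine measure_mono_null ?_ (measure_union_null h1
        (hH.measure_compl_eq_zero hU.1 hU.2 hzU))
      intro y hy
      by_cases hyG : y ∈ G
      · exact Or.inl fun h => hy ⟨hyG, h⟩
      · exact Or.inr hyG) with h | h
  · exact absurd (show x ∈ {z ∈ G | f z = f x} from ⟨hx, rfl⟩) (by rw [h]; exact id)
  · exact fun y hy => (h.symm.subset hy).2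

/-- Every point `x` of a `𝒫`-set has a connected open neighborhood `G` with a positive function `p`
which is harmonic off a compact subset `C` containing `x`, strictly positive on
`G`, and vanishes continuously at the boundary of `G`. -/
lemma IsPSet.exists_potential (hH : IsNormalBauerFamily 𝒱 H) (hell : IsElliptic 𝒱 H)
    (hW : IsPSet 𝒱 H W) {x : X} (hx : x ∈ W) :
    ∃ (G C : Set X) (p : X → ℝ), IsOpen G ∧ IsCompact (closure G) ∧ G ⊆ W ∧ x ∈ C ∧
      IsCompact C ∧ C ⊆ G ∧ LowerSemicontinuousOn p G ∧ IsHarmonic 𝒱 H (G \ C) p ∧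
      (∀ y ∈ G, 0 < p y) ∧ (∀ y ∈ closure G \ G, p y = 0) ∧
      ∀ y ∈ closure G, y ∉ C → ContinuousWithinAt p (closure G) y := by
  obtain ⟨V, hV, hxV, hVW⟩ := hH.exists_mem_closure_subset (hW.1.mem_nhds hx)
  have hVo := hH.isOpen hV
  have := hH.isMarkovKernel hV
  have hVW' : V ⊆ W := subset_closure.trans hVW
  set G := connectedComponentIn V x with hG
  have hGo : IsOpen G := hW.isOpen_connectedComponentIn hH hVo hVW' x
  have hGV : G ⊆ V := connectedComponentIn_subset _ _
  have hGVc : closure G ⊆ closure V := closure_mono hGV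
  have hGpre : IsPreconnected G := isPreconnected_connectedComponentIn
  have hxG : x ∈ G := mem_connectedComponentIn hxV
  have hGW : G ⊆ W := hGV.trans hVW'
  obtain ⟨C, hC, hxC, hCG⟩ := exists_compact_subset hGo hxG
  obtain ⟨φ, hφ0, hφ1, hφ⟩ := exists_continuous_zero_one_of_isClosed
    (s := (interior C)ᶜ) (t := {x}) isOpen_interior.isClosed_compl isClosed_singleton
    (disjoint_singleton_right.2 fun h => h hxC)
  obtain ⟨w, hw, hw1, hφw, hwh, hwleast⟩ := hW.exists_reduced hH ⟨x, hx⟩ φ.continuous hφ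
    hC.isClosed (fun y hy => hφ0 fun h => hy (interior_subset h))
  have hwx : w x = 1 := le_antisymm (hw1 x) (by
    have := hφw x
    rwa [hφ1 rfl] at this)
  have hwb := hw.isBoundedBorel
  have hfrC : frontier V ⊆ W \ C := fun z hz => ⟨hVW hz.1, fun h => by
    rw [hVo.frontier_eq] at hz
    exact hz.2 (hGV (hCG h))⟩
  have hHwc : ContinuousOn (fun y => ∫ z, w z ∂(H V y)) (closure V) :=
    hH.continuousOn_closure_integral hV (hwh.1.mono hfrC)
  -- Subtracting `H_V w` forces zero boundary values, continuously because `w` is continuous on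
  -- `∂V`, which misses `C`.
  set p : X → ℝ := fun y => w y - ∫ z, w z ∂(H V y) with hp
  have hpb : IsBoundedBorel p := hwb.sub (hwb.integral_kernel (H V))
  have hp0 : ∀ y, 0 ≤ p y := by
    intro y
    by_cases hy : y ∈ V
    · exact sub_nonneg.2 (hw.integral_le V ⟨hV, hVW⟩ y hy)
    · simp only [hp]
      rw [hH.integral_of_notMem hV hy, sub_self]
  have hpout : ∀ y ∉ V, p y = 0 := fun y hy => by
    simp only [hp]
    rw [hH.integral_of_notMem hV hy, sub_self]
  have hplsc : LowerSemicontinuousOn p G := by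
    simp only [hp, sub_eq_add_neg]
    exact (hw.lowerSemicontinuousOn.mono hGW).add
      ((hHwc.mono (hGV.trans subset_closure)).neg.lowerSemicontinuousOn)
  have hpint : ∀ U ∈ inside 𝒱 G, ∀ z, ∫ y, p y ∂(H U z) =
      ∫ y, w y ∂(H U z) - ∫ y, w y ∂(H V z) := by
    intro U hU z
    have := hH.isMarkovKernel hU.1
    rw [integral_sub (hwb.integrable _) ((hwb.integral_kernel _).integrable _),
      hH.integral_integral hU.1 hV (subset_closure.trans (hU.2.trans hGV)) hwb]
  have hpsup : IsBoundedSupermean 𝒱 H G p := ⟨hplsc, hpb, hp0, fun U hU z hz => by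
    rw [hpint U hU]
    exact sub_le_sub_right (hw.integral_le U ⟨hU.1, hU.2.trans hGW⟩ z hz) _⟩
  have hppos : ∀ y ∈ G, 0 < p y := by
    by_contra! hcon
    obtain ⟨y₀, hy₀, hle⟩ := hcon
    have hy₀0 : p y₀ = 0 := le_antisymm hle (hp0 y₀)
    have hpG : ∀ y ∈ G, w y = ∫ z, w z ∂(H V y) := fun y hy => sub_eq_zero.1
      ((hpsup.eq_of_isMinOn hH hell hW hGpre hGo hGW hy₀ (fun y _ => hy₀0 ▸ hp0 y) y hy).trans
        hy₀0)
    -- Now `w` is harmonic near `C` too, so its maximum `1` at `x` spreads over the component of `x`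
    -- in all of `W`.
    set G₀ := connectedComponentIn W x with hG₀
    have hG₀o : IsOpen G₀ := hW.isOpen_connectedComponentIn hH hW.1 Subset.rfl x
    have hG₀W : G₀ ⊆ W := connectedComponentIn_subset _ _
    have hG₀pre : IsPreconnected G₀ := isPreconnected_connectedComponentIn
    have hxG₀ : x ∈ G₀ := mem_connectedComponentIn hx
    have hGG₀ : G ⊆ G₀ := hGpre.subset_connectedComponentIn hxG hGW
    have hwG₀ : ∀ y ∈ G₀, w y = 1 := by
      refine hW.eq_one_of_harmonic hH hell hG₀pre hG₀o hG₀W hwb hw1 ?_ ?_ hxG₀ hwx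
      · intro y hy
        refine ContinuousAt.continuousWithinAt ?_
        by_cases hyC : y ∈ C
        · have hGy := hGo.mem_nhds (hCG hyC)
          refine ((hHwc.mono (hGV.trans subset_closure)).continuousAt hGy).congr ?_
          filter_upwards [hGy] with z hz using (hpG z hz).symm
        · exact hwh.1.continuousAt ((hW.1.sdiff hC.isClosed).mem_nhds ⟨hG₀W hy, hyC⟩)
      · intro z hz
        by_cases hzC : z ∈ C
        · refine ⟨G, hGo.mem_nhds (hCG hzC), fun U hU hzU => ?_⟩
          rw [hpG z (hCG hzC), ← hH.integral_integral hU.1 hV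
            (subset_closure.trans (hU.2.trans hGV)) hwb]
          exact integral_congr_ae ((hH.ae_mem hU.1 hU.2 hzU).mono hpG)
        · exact ⟨W \ C, (hW.1.sdiff hC.isClosed).mem_nhds ⟨hG₀W hz, hzC⟩,
            fun U hU hzU => hwh.2 U hU z hzU⟩
    obtain ⟨y, hy, hyx⟩ : ∃ y ∈ G₀, y ≠ x := by
      by_contra! h
      refine hH.not_isOpen_singleton x ?_
      rwa [← (show G₀ = {x} from (Set.eq_singleton_iff_unique_mem).2 ⟨hxG₀, h⟩)]
    obtain ⟨f, hf, hfne⟩ := hW.exists_isBoundedSupermean hH (hG₀W hy) hx hyx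
    obtain ⟨a, haC, hamin⟩ := (hf.lowerSemicontinuousOn.mono (hCG.trans hGW)).exists_isMinOn
      ⟨x, interior_subset hxC⟩ hC
    -- With `f a` the minimum of `f` on `C`, `f a * φ ≤ f` everywhere, as `φ ≤ 1` vanishes off `C`.
    -- Minimality of `w` and `w = 1` then give `f a ≤ f` on `G₀`.
    have hle := hwleast f hf (f a) (hf.nonneg a) (by
      intro z
      by_cases hzC : z ∈ C
      · exact (mul_le_of_le_one_right (hf.nonneg a) (hφ z).2).trans (isMinOn_iff.1 hamin z hzC)
      · rw [hφ0 (fun h => hzC (interior_subset h)), Pi.zero_apply, mul_zero]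
        exact hf.nonneg z)
    have hconst := (hf.mono hG₀W).eq_of_isMinOn hH hell hW hG₀pre hG₀o hG₀W
      (hGG₀ (hCG haC)) (fun z hz => by simpa [hwG₀ z hz] using hle z (hG₀W hz))
    exact hfne ((hconst y hy).trans (hconst x hxG₀).symm)
  have hpc : ∀ y ∈ closure G, y ∉ C → ContinuousWithinAt p (closure G) y := by
    intro y hy hyC
    exact (hwh.1.continuousAt ((hW.1.sdiff hC.isClosed).mem_nhds
      ⟨hVW (hGVc hy), hyC⟩)).continuousWithinAt.sub ((hHwc y (hGVc hy)).mono hGVc)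
  refine ⟨G, C, p, hGo, (hH.isCompact_closure V hV).of_isClosed_subset isClosed_closure hGVc, hGW,
    interior_subset hxC, hC, hCG, hplsc, ⟨?_, ?_⟩, hppos, ?_, hpc⟩
  · exact fun y hy => (hpc y (subset_closure hy.1) hy.2).mono
      (sdiff_subset.trans subset_closure)
  · intro U hU z hz
    rw [hpint U ⟨hU.1, hU.2.trans sdiff_subset⟩ z,
      hwh.2 U ⟨hU.1, hU.2.trans (sdiff_subset_sdiff_left hGW)⟩ z hz]
  · exact fun y hy => hpout y fun h => hy.2
      (closure_connectedComponentIn_inter_subset hxV ⟨hy.1, h⟩)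

/-- In the elliptic case, every point of a `𝒫`-set has a strongly stable compact neighborhood. -/
lemma IsPSet.exists_isStronglyStable (hH : IsNormalBauerFamily 𝒱 H) (hell : IsElliptic 𝒱 H)
    (hW : IsPSet 𝒱 H W) {x : X} (hx : x ∈ W) :
    ∃ N : Set X, IsStronglyStable 𝒱 H N ∧ N ∈ 𝓝 x ∧ N ⊆ W := by
  obtain ⟨G, C, p, hGo, hGc, hGW, hxC, hC, hCG, hplsc, hph, hppos, hpzero, hpc⟩ :=
    hW.exists_potential hH hell hx
  obtain ⟨a, haC, hamin⟩ := (hplsc.mono hCG).exists_isMinOn ⟨x, hxC⟩ hC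
  have ha := hppos a (hCG haC)
  -- Half the minimum of `p` on `C` puts `C` into the interior of the level set, so `p` is
  -- continuous on its boundary and equals `c` there.
  set c := p a / 2 with hc
  have hc0 : 0 < c := half_pos ha
  have hcC : ∀ y ∈ C, c < p y := fun y hy => (half_lt_self ha).trans_le (isMinOn_iff.1 hamin y hy)
  set N : Set X := {y ∈ G | c ≤ p y} with hN
  have hNG : N ⊆ G := sep_subset _ _
  have hNnhds : ∀ y ∈ G, c < p y → N ∈ 𝓝 y := by
    intro y hyG hy
    have h1 := hplsc y hyG c hy
    rw [hGo.nhdsWithin_eq hyG] at h1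
    filter_upwards [hGo.mem_nhds hyG, h1] with z hz hcz using ⟨hz, hcz.le⟩
  have hCN : C ⊆ N := fun y hy => ⟨hCG hy, (hcC y hy).le⟩
  have hNclosed : IsClosed N := by
    refine isClosed_of_closure_subset fun y hy => ?_
    by_cases hyC : y ∈ C
    · exact hCN hyC
    have hyG : y ∈ closure G := closure_mono hNG hy
    have := mem_closure_iff_nhdsWithin_neBot.1 hy
    have hle : c ≤ p y := ge_of_tendsto
      ((hpc y hyG hyC).mono_left (nhdsWithin_mono y (hNG.trans subset_closure)))
      (eventually_nhdsWithin_of_forall fun z hz => hz.2)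
    refine ⟨?_, hle⟩
    by_contra hyG'
    rw [hpzero y ⟨hyG, hyG'⟩] at hle
    exact hle.not_gt hc0
  have hsub : G \ N ⊆ G \ C := sdiff_subset_sdiff_right hCN
  refine ⟨N, ⟨hGc.of_isClosed_subset hNclosed (hNG.trans subset_closure), ⟨x, hCN hxC⟩, G,
    hW.mono hGo hGW, hNG, fun y => c - p y, ⟨?_, ?_⟩, ?_, ?_⟩, hNnhds x (hCG hxC) (hcC x hxC),
    hNG.trans hGW⟩
  · exact continuousOn_const.sub (hph.1.mono hsub)
  · intro U hU z hz
    have := hH.isMarkovKernel hU.1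
    have hU' : U ∈ inside 𝒱 (G \ C) := ⟨hU.1, hU.2.trans hsub⟩
    rw [integral_sub (integrable_const c) (hph.integrable hH hU' hz), hph.2 U hU' z hz]
    simp
  · intro y hy
    exact sub_pos.2 (not_le.1 fun h => hy.2 ⟨hy.1, h⟩)
  · intro z hz
    have hzN : z ∈ N := hNclosed.frontier_subset hz
    have hnot : N ∉ 𝓝 z := fun h => hz.2 (mem_interior_iff_mem_nhds.2 h)
    have hzC : z ∉ C := fun h => hnot (hNnhds z (hCG h) (hcC z h))
    have hpz : p z = c := le_antisymm (not_lt.1 fun h => hnot (hNnhds z hzN.1 h)) hzN.2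
    have h1 : Tendsto p (𝓝[G \ N] z) (𝓝 c) := hpz ▸
      (hpc z (subset_closure hzN.1) hzC).mono_left
        (nhdsWithin_mono z (sdiff_subset.trans subset_closure))
    simpa using h1.const_sub c

end BauerFamily

/-! ### The covering argument -/

theorem proposition5p2 {X : Type*} [TopologicalSpace X] [T2Space X] [LocallyCompactSpace X]
    [SecondCountableTopology X] [MeasurableSpace X] [BorelSpace X]
    (𝒱 : Set (Set X)) (H : Set X → Kernel X X)
    (hH : BauerFamily.IsNormalBauerFamily 𝒱 H) (hell : BauerFamily.IsElliptic 𝒱 H)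
    (W : Set X) (hW : BauerFamily.IsPSet 𝒱 H W)
    (L : Set X) (hL : IsCompact L) (hLW : L ⊆ W) :
    ∃ K : Set X, BauerFamily.IsStable 𝒱 H K ∧ L ⊆ interior K ∧ K ⊆ W ∧
      ∃ (t : Finset X) (N : X → Set X), (∀ x ∈ t, x ∈ L) ∧
        (∀ x ∈ t, BauerFamily.IsStronglyStable 𝒱 H (N x) ∧ N x ∈ 𝓝 x ∧ N x ⊆ W) ∧
        K = ⋃ x ∈ t, N x := by
  have hN : ∀ x ∈ L, ∃ N : Set X, BauerFamily.IsStronglyStable 𝒱 H N ∧ N ∈ 𝓝 x ∧ N ⊆ W :=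
    fun x hx => hW.exists_isStronglyStable hH hell (hLW hx)
  choose! N hNs hNx hNW using hN
  obtain ⟨t, htL, hLt⟩ := hL.elim_nhds_subcover (fun x => interior (N x))
    fun x hx => interior_mem_nhds.2 (hNx x hx)
  have hKc : IsCompact (⋃ x ∈ t, N x) := t.isCompact_biUnion fun x hx => (hNs x (htL x hx)).1
  have hKW : (⋃ x ∈ t, N x) ⊆ W := iUnion₂_subset fun x hx => hNW x (htL x hx)
  refine ⟨⋃ x ∈ t, N x, ⟨hKc, ⟨W, hW, hKW⟩, ?_⟩, ?_, hKW, t, N, htL,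
    fun x hx => ⟨hNs x (htL x hx), hNx x (htL x hx), hNW x (htL x hx)⟩, rfl⟩
  · intro z hz
    obtain ⟨x, hxt, hzx⟩ := mem_iUnion₂.1 (hKc.isClosed.frontier_subset hz)
    obtain ⟨-, -, W', hW', hNW', h, hh, hpos, hlim⟩ := hNs x (htL x hxt)
    have hNK : N x ⊆ ⋃ x ∈ t, N x := subset_biUnion_of_mem (u := N) hxt
    have hsub : W' \ (⋃ x ∈ t, N x) ⊆ W' \ N x := sdiff_subset_sdiff_right hNK
    refine ⟨W', hW'.1, hNW' hzx, fun y => (h y : EReal),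
      (hh.mono hsub).isSuperharmonic hH (hW'.1.sdiff hKc.isClosed),
      fun y hy => EReal.coe_pos.2 (hpos y (hsub hy)), ?_⟩
    -- An interior point of one piece is interior to the union, so `z` lies on the boundary of the
    -- piece containing it.
    have hzf : z ∈ frontier (N x) := ⟨subset_closure hzx, fun hi => hz.2 (interior_mono hNK hi)⟩
    have h1 := (hlim z hzf).mono_left (nhdsWithin_mono z hsub)
    exact (continuous_coe_real_ereal.tendsto 0).comp h1
  · exact hLt.trans (iUnion₂_subset fun x hx =>
      interior_mono (subset_biUnion_of_mem (u := N) hx))
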